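/- Let $m>0$ and $\kappa=\frac{\pi}{2}$. Let $\sigma^1=\begin{pmatrix}0&1\\1&0\end{pmatrix}$, $\sigma^2=\begin{pmatrix}0&-i\\i&0\end{pmatrix}$, $\sigma^3=\begin{pmatrix}1&0\\0&-1\end{pmatrix}$ be the Pauli matrices, and let $\beta=\begin{pmatrix}I&0\\0&-I\end{pmatrix}$ and $\alpha_k=\begin{pmatrix}0&\sigma^k\\\sigma^k&0\end{pmatrix}$, $k=1,2,3$, be the $4\times4$ Dirac matrices. Write $\langle z,w\rangle=\sum_{i=1}^4\bar z_iw_i$ for $z,w\in\mathbb C^4$, $\|\cdot\|$ for the norm of $L^2(\mathbb R^3,\mathbb C^4)$, $\hat\psi(p)=(2\pi)^{-3/2}\int_{\mathbb R^3} e^{-ip\cdot x}\psi(x)\,dx$ for the unitary Fourier transform (extended to $L^2$), $\lambda(p)=\sqrt{|p|^2+m^2}$, and $$\|\psi\|_H^2=\int_{\mathbb R^3}\lambda(p)\,|\hat\psi(p)|^2\,dp ,\qquad \psi\in X=H^{1/2}(\mathbb R^3,\mathbb C^4).$$ Let $\Lambda_\pm$ be the orthogonal projectors onto the positive and negative energy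 subspaces of the Dirac operator $-i\boldsymbol\alpha\cdot\nabla+m\beta$, that is, the operators given in Fourier variables by multiplication with $\frac12\left(I\pm\frac{m}{\lambda(p)}\beta\pm\frac{1}{\lambda(p)}\boldsymbol\alpha\cdot p\right)$. Put $X_\pm=\Lambda_\pm X$ and $\Sigma_+=\{w\in X_+:\|w\|=1\}$. Let $w\in\Sigma_+$ and $\eta\in X_-$ with $\|\eta\|\le1$, and put $a(\eta)=\sqrt{1-\|\eta\|^2}$ and $\psi=a(\eta)w+\eta$. Then the two double integrals below converge absolutely, and $$\int_{\mathbb R^3\times\mathbb R^3}\frac{\langle\psi,\beta\psi\rangle(x)\,\langle\psi,\beta\psi\rangle(y)}{|x-y|}\,dx\,dy\;\ge\;\int_{\mathbb R^3\times\mathbb R^3}\frac{\langle w,\beta w\rangle(x)\,\langle w,\beta w\rangle(y)}{|x-y|}\,dx\,dy-2\kappa\|\eta\|^2\|w\|_H^2-14\,a(\eta)^2\kappa\left(\|w\|_H^2-m\|w\|^2\right)-18\,\kappa\|\eta\|_H^2 .$$ -/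

import Mathlib

open MeasureTheory FourierTransform
open scoped SchwartzMap

noncomputable section

namespace DiracKG

/-! ### Dirac matrices -/

/-- Physical (and momentum) space `ℝ³`. -/
abbrev R3 : Type := EuclideanSpace ℝ (Fin 3)

/-- Spinor space `ℂ⁴`, with the inner product `⟨z, w⟩ = ∑ i, conj (z i) * w i`. -/
abbrev C4 : Type := EuclideanSpace ℂ (Fin 4)

/-- `L²(ℝ³, ℂ⁴)`. -/
abbrev L2 : Type := Lp C4 2 (volume : Measure R3)

/-- The Pauli matrices `σ¹, σ², σ³`. -/
def pauli : Fin 3 → Matrix (Fin 2) (Fin 2) ℂ :=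
  ![!![0, 1; 1, 0], !![0, -Complex.I; Complex.I, 0], !![1, 0; 0, -1]]

/-- The `4 × 4` matrix with `2 × 2` blocks `A B` in the first row and `C D` in the second. -/
def ofBlocks (A B C D : Matrix (Fin 2) (Fin 2) ℂ) : Matrix (Fin 4) (Fin 4) ℂ :=
  Matrix.reindex finSumFinEquiv finSumFinEquiv (Matrix.fromBlocks A B C D)

/-- `β = γ⁰`. -/
def beta : Matrix (Fin 4) (Fin 4) ℂ := ofBlocks 1 0 0 (-1)

/-- The Dirac matrices `γ¹, γ², γ³`. -/
def gammaMat (k : Fin 3) : Matrix (Fin 4) (Fin 4) ℂ := ofBlocks 0 (pauli k) (-pauli k) 0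

/-- `αₖ = β γᵏ`. -/
def alpha (k : Fin 3) : Matrix (Fin 4) (Fin 4) ℂ := beta * gammaMat k

/-- The action of a matrix on a spinor. -/
abbrev act (A : Matrix (Fin 4) (Fin 4) ℂ) : C4 →L[ℂ] C4 := Matrix.toEuclideanCLM (𝕜 := ℂ) A

/-! ### The Fourier transform and the form norm -/

theorem quasiMeasurePreserving_rescale :
    Measure.QuasiMeasurePreserving (fun p : R3 => (2 * Real.pi)⁻¹ • p) volume volume := by
  have hpi : (2 * Real.pi) ≠ 0 := by positivity
  refine ⟨by fun_prop, ?_⟩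
  rw [Measure.map_addHaar_smul volume (inv_ne_zero hpi)]
  exact Measure.smul_absolutelyContinuous

/-- `ψ̂(p) = (2π)^(-3/2) ∫ e^{-i p·x} ψ(x) dx`, the unitary Fourier transform in the angular
frequency `p`, for `ψ ∈ L²`. Mathlib's `𝓕` uses the phase `e^{-2πi ξ·x}`, so that `p = 2πξ`. -/
def hat (ψ : L2) (p : R3) : C4 :=
  ((2 * Real.pi) ^ (-(3 / 2) : ℝ) : ℝ) • (𝓕 ψ : L2) ((2 * Real.pi)⁻¹ • p)

/-- On Schwartz functions, `hat` is given by the integral formula. -/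
theorem hat_schwartz (f : 𝓢(R3, C4)) :
    ∀ᵐ p : R3, hat (f.toLp 2) p = ((2 * Real.pi) ^ (-(3 / 2) : ℝ) : ℝ) •
      ∫ x : R3, Complex.exp (-Complex.I * (inner ℝ p x : ℝ)) • f x := by
  have hpi : (2 * Real.pi) ≠ 0 := by positivity
  have h := (𝓕 f).coeFn_toLp 2 (volume : Measure R3)
  filter_upwards [quasiMeasurePreserving_rescale.ae h] with p hp
  unfold hat
  rw [SchwartzMap.toLp_fourier_eq, hp, SchwartzMap.fourier_coe, Real.fourier_eq']
  congr 2
  funext x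
  congr 2
  rw [inner_smul_right, real_inner_comm]
  push_cast
  have : (Real.pi : ℂ) ≠ 0 := by exact_mod_cast Real.pi_ne_zero
  field_simp

/-- `λ(p) = √(|p|² + m²)`. -/
def lam (m : ℝ) (p : R3) : ℝ := Real.sqrt (‖p‖ ^ 2 + m ^ 2)

/-- `‖ψ‖_H = (∫ √(|p|² + m²) |ψ̂(p)|² dp)^(1/2)`. -/
def hNorm (m : ℝ) (ψ : L2) : ℝ := Real.sqrt (∫ p : R3, lam m p * ‖hat ψ p‖ ^ 2)

/-- The Sobolev space `X = H^{1/2}(ℝ³, ℂ⁴)`, as a subset of `L²(ℝ³, ℂ⁴)`. -/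
def X : Set L2 := {ψ | TemperedDistribution.MemSobolev (1 / 2) 2 (ψ : 𝓢'(R3, C4))}

/-! ### The energy projectors -/

/-- For `ε = ±1`, the symbol `½ (I + ε (m/λ(p)) β + ε (1/λ(p)) α·p)` of the projector `Λ_±`. -/
def projSymbol (m ε : ℝ) (p : R3) : Matrix (Fin 4) (Fin 4) ℂ :=
  (1 / 2 : ℂ) • (1 + ((ε * (m / lam m p) : ℝ) : ℂ) • beta
    + ((ε * (1 / lam m p) : ℝ) : ℂ) • ∑ k, ((p k : ℝ) : ℂ) • alpha k)

theorem act_projSymbol (m ε : ℝ) (p : R3) (v : C4) :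
    act (projSymbol m ε p) v = (1 / 2 : ℂ) • (v + ((ε * (m / lam m p) : ℝ) : ℂ) • act beta v
      + ((ε * (1 / lam m p) : ℝ) : ℂ) • ∑ k, ((p k : ℝ) : ℂ) • act (alpha k) v) := by
  have hs : act (∑ k, ((p k : ℝ) : ℂ) • alpha k) v
      = ∑ k, ((p k : ℝ) : ℂ) • act (alpha k) v := by
    simp only [act, map_sum, sum_apply]
    exact Finset.sum_congr rfl fun k _ => by
      rw [map_smul, smul_apply]
  rw [← hs]
  simp only [act, projSymbol, map_add, map_smul, map_one, smul_apply,
    add_apply, one_apply_eq_self]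

theorem measurable_lam (m : ℝ) : Measurable (lam m) := by
  unfold lam; fun_prop

theorem norm_act_projSymbol_le (m ε : ℝ) : ∃ C : ℝ, ∀ (p : R3) (v : C4),
    ‖act (projSymbol m ε p) v‖ ≤ C * ‖v‖ := by
  refine ⟨1 / 2 * (1 + |ε| * ‖act beta‖ + |ε| * ∑ k, ‖act (alpha k)‖), fun p v => ?_⟩
  have hl : 0 ≤ lam m p := Real.sqrt_nonneg _
  have hm : |m / lam m p| ≤ 1 := by
    rw [abs_div, abs_of_nonneg hl]
    exact div_le_one_of_le₀ (Real.abs_le_sqrt (by nlinarith [sq_nonneg ‖p‖])) hl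
  have hp : ∀ k, 1 / lam m p * |p k| ≤ 1 := fun k => by
    rw [one_div_mul_eq_div]
    refine div_le_one_of_le₀ (Real.abs_le_sqrt ?_) hl
    have := PiLp.norm_apply_le p k
    rw [Real.norm_eq_abs] at this
    nlinarith [abs_nonneg (p k), sq_abs (p k), sq_nonneg m]
  rw [act_projSymbol, norm_smul]
  have h1 : ‖((ε * (m / lam m p) : ℝ) : ℂ) • act beta v‖ ≤ |ε| * ‖act beta‖ * ‖v‖ := by
    rw [norm_smul, Complex.norm_real, Real.norm_eq_abs, abs_mul, mul_assoc, mul_assoc]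
    refine mul_le_mul_of_nonneg_left ?_ (abs_nonneg ε)
    calc |m / lam m p| * ‖act beta v‖ ≤ 1 * ‖act beta v‖ := by gcongr
      _ ≤ ‖act beta‖ * ‖v‖ := by rw [one_mul]; exact (act beta).le_opNorm v
  have h2 : ‖((ε * (1 / lam m p) : ℝ) : ℂ) • ∑ k, ((p k : ℝ) : ℂ) • act (alpha k) v‖
      ≤ |ε| * (∑ k, ‖act (alpha k)‖) * ‖v‖ := by
    rw [norm_smul, Complex.norm_real, Real.norm_eq_abs, abs_mul, mul_assoc, mul_assoc,
      abs_of_nonneg (one_div_nonneg.2 hl)]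
    refine mul_le_mul_of_nonneg_left ?_ (abs_nonneg ε)
    calc 1 / lam m p * ‖∑ k, ((p k : ℝ) : ℂ) • act (alpha k) v‖
        ≤ 1 / lam m p * ∑ k, |p k| * ‖act (alpha k) v‖ := by
          gcongr
          refine (norm_sum_le _ _).trans (Finset.sum_le_sum fun k _ => ?_)
          rw [norm_smul, Complex.norm_real, Real.norm_eq_abs]
      _ = ∑ k, (1 / lam m p * |p k|) * ‖act (alpha k) v‖ := by
          rw [Finset.mul_sum]; exact Finset.sum_congr rfl fun k _ => by ring
      _ ≤ ∑ k, 1 * (‖act (alpha k)‖ * ‖v‖) := by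
          refine Finset.sum_le_sum fun k _ => ?_
          gcongr
          · exact hp k
          · exact (act (alpha k)).le_opNorm v
      _ = (∑ k, ‖act (alpha k)‖) * ‖v‖ := by simp [Finset.sum_mul]
  have h3 : ‖(1 / 2 : ℂ)‖ = 1 / 2 := by simp
  rw [h3, mul_assoc]
  gcongr
  refine (norm_add₃_le).trans ?_
  linarith

theorem memLp_projSymbol (m ε : ℝ) (f : L2) :
    MemLp (fun ξ : R3 => act (projSymbol m ε ((2 * Real.pi) • ξ)) (f ξ)) 2 volume := by
  obtain ⟨C, hC⟩ := norm_act_projSymbol_le m ε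
  refine (Lp.memLp f).of_le_mul ?_ (Filter.Eventually.of_forall fun ξ => hC _ (f ξ))
  have hf := (Lp.memLp f).aestronglyMeasurable
  have hl : Measurable fun ξ : R3 => lam m ((2 * Real.pi) • ξ) :=
    (measurable_lam m).comp (by fun_prop)
  simp_rw [act_projSymbol]
  have hA : ∀ A : C4 →L[ℂ] C4, AEStronglyMeasurable (fun ξ => A (f ξ)) volume :=
    fun A => A.continuous.comp_aestronglyMeasurable hf
  have h1 : Measurable fun ξ : R3 => ((ε * (m / lam m ((2 * Real.pi) • ξ)) : ℝ) : ℂ) :=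
    Complex.measurable_ofReal.comp ((hl.const_div m).const_mul ε)
  have h2 : Measurable fun ξ : R3 => ((ε * (1 / lam m ((2 * Real.pi) • ξ)) : ℝ) : ℂ) :=
    Complex.measurable_ofReal.comp ((hl.const_div 1).const_mul ε)
  have h3 : ∀ k, Measurable fun ξ : R3 => ((((2 * Real.pi) • ξ : R3) k : ℝ) : ℂ) :=
    fun k => Complex.measurable_ofReal.comp (by fun_prop)
  have h4 : AEStronglyMeasurable (fun ξ : R3 =>
      ∑ k, ((((2 * Real.pi) • ξ : R3) k : ℝ) : ℂ) • act (alpha k) (f ξ)) volume :=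
    Finset.aestronglyMeasurable_fun_sum _ fun k _ =>
      (h3 k).aestronglyMeasurable.fun_smul (hA _)
  exact ((hf.fun_add (h1.aestronglyMeasurable.fun_smul (hA _))).fun_add
    (h2.aestronglyMeasurable.fun_smul h4)).fun_const_smul _

/-- The projectors `Λ₊` (`ε = 1`) and `Λ₋` (`ε = -1`) onto the positive and negative energy
subspaces of `H = -i α·∇ + m β`: the operators on `L²(ℝ³, ℂ⁴)` with symbol `projSymbol`. -/
def energyProj (m ε : ℝ) (ψ : L2) : L2 := 𝓕⁻ ((memLp_projSymbol m ε (𝓕 ψ)).toLp _)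

/-- In the variable `p`, the operator `energyProj` is multiplication by `projSymbol`. -/
theorem hat_energyProj (m ε : ℝ) (ψ : L2) :
    ∀ᵐ p : R3, hat (energyProj m ε ψ) p = act (projSymbol m ε p) (hat ψ p) := by
  have hpi : (2 * Real.pi) ≠ 0 := by positivity
  have h := (memLp_projSymbol m ε (𝓕 ψ)).coeFn_toLp
  filter_upwards [quasiMeasurePreserving_rescale.ae h] with p hp
  unfold hat energyProj
  rw [fourier_fourierInv_eq, hp, smul_inv_smul₀ hpi]
  simp only [← Complex.coe_smul, map_smul]

/-- `X₊ = Λ₊ X`. -/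
def XPlus (m : ℝ) : Set L2 := energyProj m 1 '' X

/-- `X₋ = Λ₋ X`. -/
def XMinus (m : ℝ) : Set L2 := energyProj m (-1) '' X

/-- `Σ₊`, the set of `w ∈ X₊` with `‖w‖_{L²} = 1`. -/
def SigmaPlus (m : ℝ) : Set L2 := {w | w ∈ XPlus m ∧ ‖w‖ = 1}

/-! ### The Coulomb-type energy -/

/-- The density `⟨ψ, βψ⟩(x)`, which is real because `β` is Hermitian. -/
def density (ψ : L2) (x : R3) : ℝ := (inner ℂ (ψ x) (act beta (ψ x))).re

theorem coe_density (ψ : L2) (x : R3) :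
    ((density ψ x : ℝ) : ℂ) = inner ℂ (ψ x) (act beta (ψ x)) := by
  have hb : IsSelfAdjoint (act beta) := by
    have : IsSelfAdjoint beta := by
      ext i j
      fin_cases i <;> fin_cases j <;>
        simp [beta, ofBlocks, Matrix.star_apply, finSumFinEquiv, Fin.addCases]
    exact this.map (Matrix.toEuclideanCLM (n := Fin 4) (𝕜 := ℂ))
  apply Complex.ext
  · simp [density]
  · have h := (ContinuousLinearMap.isSelfAdjoint_iff_isSymmetric.1 hb) (ψ x) (ψ x)
    simp only [ContinuousLinearMap.coe_coe] at h
    have h3 := congrArg Complex.im (inner_conj_symm (𝕜 := ℂ) (ψ x) (act beta (ψ x)))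
    rw [h, Complex.conj_im] at h3
    rw [Complex.ofReal_im]
    linarith

/-- The integrand `⟨ψ, βψ⟩(x) ⟨ψ, βψ⟩(y) / |x - y|` on `ℝ³ × ℝ³`. -/
def coulombIntegrand (ψ : L2) (z : R3 × R3) : ℝ :=
  density ψ z.1 * density ψ z.2 / ‖z.1 - z.2‖

/-- The energy `∫∫ ⟨ψ, βψ⟩(x) ⟨ψ, βψ⟩(y) / |x - y| dx dy`. -/
def coulombEnergy (ψ : L2) : ℝ := ∫ z : R3 × R3, coulombIntegrand ψ z

/-- `a(η) = √(1 - ‖η‖²)`. -/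
def amp (η : L2) : ℝ := Real.sqrt (1 - ‖η‖ ^ 2)

/-- The constant `κ = π / 2`. -/
def kappa : ℝ := Real.pi / 2

end DiracKG

end

open MeasureTheory FourierTransform
open scoped SchwartzMap LineDeriv ENNReal

namespace DiracKG

/-! With s = ‖η‖ and a² + s² = 1, the density of ψ is a²⟨w,βw⟩ + ⟨η,βη⟩ + 2a Re⟨w,βη⟩. Multiplying
out the Coulomb energy gives a⁴ times the energy of w plus cross terms; these are bounded by the
pair energies ∬|u(x)|²|v(y)|²/|x-y| because |⟨u,βv⟩| ≤ |u||v|. The mixed terms of odd order in η are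
split by Young's inequality with weights s and 1/s (`density_product_ge`).

Each pair energy is controlled by Kato's inequality |x-y|⁻¹ ≤ 2√(-Δ) (`kato`). The constant 2, not
the sharp π/2, leaves enough room in the final coefficients. It comes from Hardy's inequality
|x-y|⁻² ≤ 4(-Δ) by operator monotonicity of the square root: resolvents are compared and then
integrated over the spectral parameter.

What remains is s⟨w,√(-Δ)w⟩, which is only of first order in s. It is absorbed using |p|² =
(λ-m)(λ+m), which bounds it by the kinetic excess ‖w‖_H² - m‖w‖² plus a multiple of s²
(`mul_momentumForm_le`). `energy_bound` collects the constants. -/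

/-! ### Hardy's inequality with a regularized weight. -/

theorem hasTemperateGrowth_inv_one_add_sq {c : ℝ} (hc : 0 < c) (y : R3) :
    (fun x : R3 => (‖x - y‖ ^ 2 + c)⁻¹).HasTemperateGrowth := by
  have h1 : (fun x : R3 => (Real.sqrt c)⁻¹ • (x - y)).HasTemperateGrowth := by fun_prop
  have h2 := (Function.hasTemperateGrowth_one_add_norm_sq_rpow R3 (-1)).comp h1
  have h3 : (fun x : R3 => (‖x - y‖ ^ 2 + c)⁻¹) =
      fun x => c⁻¹ * ((fun x : R3 => (1 + ‖x‖ ^ 2) ^ (-1 : ℝ)) ∘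
        fun x : R3 => (Real.sqrt c)⁻¹ • (x - y)) x := by
    funext x
    have hs : 0 < Real.sqrt c := Real.sqrt_pos.2 hc
    simp only [Function.comp, Real.rpow_neg_one, norm_smul, norm_inv, Real.norm_eq_abs,
      abs_of_pos hs, mul_pow, inv_pow, Real.sq_sqrt hc.le]
    rw [← mul_inv]
    congr 1
    field_simp
    ring
  rw [h3]
  fun_prop

/-- The components of the vector field `(x - y) / (|x - y|² + c)`. -/
noncomputable def hardyField (c : ℝ) (y : R3) (j : Fin 3) (x : R3) : ℝ :=
  (x j - y j) * (‖x - y‖ ^ 2 + c)⁻¹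

theorem hasTemperateGrowth_hardyField {c : ℝ} (hc : 0 < c) (y : R3) (j : Fin 3) :
    (hardyField c y j).HasTemperateGrowth := by
  have h : (fun x : R3 => x j).HasTemperateGrowth :=
    (EuclideanSpace.proj (𝕜 := ℝ) j).hasTemperateGrowth
  have h2 := hasTemperateGrowth_inv_one_add_sq hc y
  unfold hardyField
  fun_prop

theorem fderiv_hardyField {c : ℝ} (hc : 0 < c) (y : R3) (j : Fin 3) (x : R3) :
    fderiv ℝ (hardyField c y j) x (EuclideanSpace.single j 1) =
      (‖x - y‖ ^ 2 + c)⁻¹ - 2 * (x j - y j) ^ 2 * ((‖x - y‖ ^ 2 + c)⁻¹) ^ 2 := by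
  have h1 : HasFDerivAt (fun x : R3 => x j - y j) (EuclideanSpace.proj (𝕜 := ℝ) j) x :=
    (EuclideanSpace.proj (𝕜 := ℝ) j).hasFDerivAt.sub_const _
  have h2 : HasFDerivAt (fun x : R3 => ‖x - y‖ ^ 2 + c) _ x :=
    (((hasFDerivAt_id x).sub_const y).norm_sq).add_const c
  have h0 : ‖x - y‖ ^ 2 + c ≠ 0 := by positivity
  have h3 := h1.mul ((hasDerivAt_inv h0).comp_hasFDerivAt x h2)
  have h4 : hardyField c y j = fun x : R3 => (x j - y j) * ((Inv.inv ∘ fun x : R3 =>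
      ‖x - y‖ ^ 2 + c) x) := rfl
  rw [h4]
  erw [h3.fderiv]
  simp [PiLp.inner_apply]
  field_simp
  ring

/-- Hardy's inequality in `ℝ³`, with a regularized weight. -/
theorem hardy_lineDeriv {c : ℝ} (hc : 0 < c) (y : R3) (u : 𝓢(R3, C4)) :
    ∫ x, (‖x - y‖ ^ 2 + c)⁻¹ * ‖u x‖ ^ 2 ≤
      4 * ∑ j : Fin 3, ∫ x, ‖(∂_{EuclideanSpace.single j (1 : ℝ)} u : 𝓢(R3, C4)) x‖ ^ 2 := by
  set D : Fin 3 → 𝓢(R3, C4) := fun j => ∂_{EuclideanSpace.single j (1 : ℝ)} u with hD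
  set f : Fin 3 → 𝓢(R3, C4) := fun j => SchwartzMap.smulLeftCLM C4 (hardyField c y j) u with hf
  set Df : Fin 3 → 𝓢(R3, C4) := fun j => ∂_{EuclideanSpace.single j (1 : ℝ)} (f j) with hDf
  have hfx : ∀ j x, f j x = hardyField c y j x • u x := fun j x => by
    rw [hf]; exact SchwartzMap.smulLeftCLM_apply_apply (hasTemperateGrowth_hardyField hc y j) u x
  have hDfx : ∀ j x, Df j x = ((‖x - y‖ ^ 2 + c)⁻¹
      - 2 * (x j - y j) ^ 2 * ((‖x - y‖ ^ 2 + c)⁻¹) ^ 2) • u x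
      + hardyField c y j x • D j x := fun j x => by
    simp only [hDf, hD, SchwartzMap.lineDerivOp_apply_eq_fderiv]
    have : (f j : R3 → C4) = fun x => hardyField c y j x • u x := funext (hfx j)
    rw [this]
    erw [fderiv_fun_smul ((hasTemperateGrowth_hardyField hc y j).1.differentiable (by simp) x)
      (u.differentiable x)]
    simp [fderiv_hardyField hc y j x, add_comm]
  let L : C4 →L[ℝ] C4 →L[ℝ] ℝ := innerSL ℝ
  have hint : ∀ g h : 𝓢(R3, C4), Integrable fun x => (inner ℝ (g x) (h x) : ℝ) := fun g h =>
    (SchwartzMap.pairing L g h).integrable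
  have hsq : ∀ g : 𝓢(R3, C4), Integrable fun x => ‖g x‖ ^ 2 := fun g => by
    simpa only [real_inner_self_eq_norm_sq] using hint g g
  have hparts : ∀ j, ∫ x, ((inner ℝ (f j x) (D j x) : ℝ) + inner ℝ (Df j x) (u x)) = 0 :=
      fun j => by
    rw [integral_add (hint _ _) (hint _ _)]
    have : ∫ x, (inner ℝ (f j x) (D j x) : ℝ) = -∫ x, (inner ℝ (Df j x) (u x) : ℝ) :=
      SchwartzMap.integral_bilinear_lineDerivOp_right_eq_neg_left (μ := volume)
        (f j) u L (EuclideanSpace.single j (1 : ℝ))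
    linarith
  -- The first three terms are the square |∂ⱼu + ½fⱼ|². The subtracted bracket has integral zero by
  -- parts; it is kept so that the cross terms ⟨u, ∂ⱼu⟩ cancel pointwise.
  have hpos : ∀ j, 0 ≤ ∫ x, (‖D j x‖ ^ 2 + inner ℝ (f j x) (D j x) + 1 / 4 * ‖f j x‖ ^ 2
      - 1 / 2 * ((inner ℝ (f j x) (D j x) : ℝ) + inner ℝ (Df j x) (u x))) := fun j => by
    have e : ∫ x, (‖D j x‖ ^ 2 + inner ℝ (f j x) (D j x) + 1 / 4 * ‖f j x‖ ^ 2
        - 1 / 2 * ((inner ℝ (f j x) (D j x) : ℝ) + inner ℝ (Df j x) (u x)))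
        = (∫ x, (‖D j x‖ ^ 2 + inner ℝ (f j x) (D j x) + 1 / 4 * ‖f j x‖ ^ 2))
        - ∫ x, 1 / 2 * ((inner ℝ (f j x) (D j x) : ℝ) + inner ℝ (Df j x) (u x)) :=
      integral_sub (((hsq _).add (hint _ _)).add ((hsq _).const_mul _))
        (((hint _ _).add (hint _ _)).const_mul _)
    rw [e, integral_const_mul, hparts j, mul_zero, sub_zero]
    refine integral_nonneg fun x => ?_
    have h := sq_nonneg ‖D j x + (1 / 2 : ℝ) • f j x‖
    rw [norm_add_sq_real, inner_smul_right, norm_smul, real_inner_comm, mul_pow] at h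
    norm_num at h ⊢
    linarith
  have hIj : ∀ j, Integrable fun x => (‖D j x‖ ^ 2 + inner ℝ (f j x) (D j x)
      + 1 / 4 * ‖f j x‖ ^ 2
      - 1 / 2 * ((inner ℝ (f j x) (D j x) : ℝ) + inner ℝ (Df j x) (u x))) := fun j =>
    (((hsq _).add (hint _ _)).add ((hsq _).const_mul _)).sub
      (((hint _ _).add (hint _ _)).const_mul _)
  have hg : Integrable fun x => (‖x - y‖ ^ 2 + c)⁻¹ * ‖u x‖ ^ 2 := by
    have := hint (SchwartzMap.smulLeftCLM C4 (fun x : R3 => (‖x - y‖ ^ 2 + c)⁻¹) u) u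
    refine this.congr (Filter.Eventually.of_forall fun x => ?_)
    simp only
    rw [SchwartzMap.smulLeftCLM_apply_apply (hasTemperateGrowth_inv_one_add_sq hc y),
      real_inner_smul_left, real_inner_self_eq_norm_sq]
  have hsum := Finset.sum_nonneg fun j (_ : j ∈ Finset.univ) => hpos j
  rw [← integral_finsetSum _ fun j _ => hIj j] at hsum
  have hle : ∫ x, ∑ j, (‖D j x‖ ^ 2 + inner ℝ (f j x) (D j x)
      + 1 / 4 * ‖f j x‖ ^ 2
      - 1 / 2 * ((inner ℝ (f j x) (D j x) : ℝ) + inner ℝ (Df j x) (u x))) ≤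
      ∫ x, (∑ j, ‖D j x‖ ^ 2 - 1 / 4 * ((‖x - y‖ ^ 2 + c)⁻¹ * ‖u x‖ ^ 2)) := by
    refine integral_mono (integrable_finsetSum _ fun j _ => hIj j)
      ((integrable_finsetSum _ fun j _ => hsq _).sub (hg.const_mul _)) fun x => ?_
    simp only
    have hr : ‖x - y‖ ^ 2 = (x 0 - y 0) ^ 2 + (x 1 - y 1) ^ 2 + (x 2 - y 2) ^ 2 := by
      rw [EuclideanSpace.norm_sq_eq]; simp [Fin.sum_univ_three]
    have hterm : ∀ j, ‖D j x‖ ^ 2 + inner ℝ (f j x) (D j x) + 1 / 4 * ‖f j x‖ ^ 2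
        - 1 / 2 * ((inner ℝ (f j x) (D j x) : ℝ) + inner ℝ (Df j x) (u x))
        = ‖D j x‖ ^ 2 + (5 / 4 * (x j - y j) ^ 2 * ((‖x - y‖ ^ 2 + c)⁻¹) ^ 2
          - 1 / 2 * (‖x - y‖ ^ 2 + c)⁻¹) * ‖u x‖ ^ 2 := fun j => by
      rw [hfx, hDfx, inner_add_left, real_inner_smul_left, real_inner_smul_left,
        real_inner_smul_left, real_inner_self_eq_norm_sq, norm_smul, mul_pow, Real.norm_eq_abs,
        sq_abs, real_inner_comm (D j x) (u x)]
      simp only [hardyField]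
      ring
    rw [Finset.sum_congr rfl fun j _ => hterm j, Finset.sum_add_distrib, ← Finset.sum_mul]
    simp only [Fin.sum_univ_three]
    have hG : 0 < ‖x - y‖ ^ 2 + c := by positivity
    have hG1 : (‖x - y‖ ^ 2 + c) * (‖x - y‖ ^ 2 + c)⁻¹ = 1 := mul_inv_cancel₀ hG.ne'
    have hG2 : 0 < (‖x - y‖ ^ 2 + c)⁻¹ := inv_pos.2 hG
    set G := (‖x - y‖ ^ 2 + c)⁻¹
    -- Summed over the three directions, the coefficient of |u|² is (5/4)|x-y|²G² - (3/2)G, so this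
    -- bound leaves at most -G/4: Hardy's constant 4.
    have h1 : ‖x - y‖ ^ 2 * G ^ 2 ≤ G := by nlinarith [mul_pos hc (pow_pos hG2 2)]
    have h2 := mul_nonneg (sub_nonneg.2 h1) (sq_nonneg ‖u x‖)
    rw [hr] at h2
    nlinarith
  rw [integral_sub (integrable_finsetSum _ fun j _ => hsq _) (hg.const_mul _),
    integral_finsetSum _ fun j _ => hsq _, integral_const_mul] at hle
  linarith

theorem hardy_fourier {c : ℝ} (hc : 0 < c) (y : R3) (u : 𝓢(R3, C4)) :
    ∫ x, (‖x - y‖ ^ 2 + c)⁻¹ * ‖u x‖ ^ 2 ≤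
      ∫ ξ, (4 * Real.pi * ‖ξ‖) ^ 2 * ‖(𝓕 u : 𝓢(R3, C4)) ξ‖ ^ 2 := by
  refine (hardy_lineDeriv hc y u).trans_eq ?_
  have hj : ∀ j : Fin 3,
      (fun ξ => ‖(𝓕 (∂_{EuclideanSpace.single j (1 : ℝ)} u) : 𝓢(R3, C4)) ξ‖ ^ 2)
      = fun ξ => (2 * Real.pi * ξ j) ^ 2 * ‖(𝓕 u : 𝓢(R3, C4)) ξ‖ ^ 2 := fun j => by
    funext ξ
    have ht : (fun x : R3 => (inner ℝ x (EuclideanSpace.single j (1 : ℝ)) : ℝ)).HasTemperateGrowth :=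
      Function.hasTemperateGrowth_inner_left _
    rw [SchwartzMap.fourier_lineDerivOp_eq, smul_apply,
      SchwartzMap.smulLeftCLM_apply_apply ht, norm_smul, norm_smul, mul_pow, mul_pow]
    simp [PiLp.inner_apply, abs_of_pos Real.pi_pos]
    ring
  have hint : ∀ j : Fin 3, Integrable fun ξ : R3 =>
      (2 * Real.pi * ξ j) ^ 2 * ‖(𝓕 u : 𝓢(R3, C4)) ξ‖ ^ 2 := fun j => by
    rw [← hj j]
    have := (SchwartzMap.pairing (innerSL ℝ : C4 →L[ℝ] C4 →L[ℝ] ℝ)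
      (𝓕 (∂_{EuclideanSpace.single j (1 : ℝ)} u))
      (𝓕 (∂_{EuclideanSpace.single j (1 : ℝ)} u))).integrable (μ := volume)
    refine this.congr (Filter.Eventually.of_forall fun x => ?_)
    exact real_inner_self_eq_norm_sq (F := C4) _
  rw [Finset.sum_congr rfl fun j _ => (SchwartzMap.integral_norm_sq_fourier
    (∂_{EuclideanSpace.single j (1 : ℝ)} u)).symm]
  simp_rw [hj]
  rw [← integral_finsetSum _ fun j _ => hint j, ← integral_const_mul]
  congr 1
  funext ξ
  rw [mul_pow _ ‖ξ‖, EuclideanSpace.norm_sq_eq ξ]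
  simp only [Fin.sum_univ_three, Real.norm_eq_abs, sq_abs]
  ring

/-! ### From Hardy to Kato: monotonicity of the square root through resolvents. -/

theorem integrable_norm_sq_schwartz (u : 𝓢(R3, C4)) : Integrable fun x => ‖u x‖ ^ 2 := by
  have := (SchwartzMap.pairing (innerSL ℝ : C4 →L[ℝ] C4 →L[ℝ] ℝ) u u).integrable (μ := volume)
  exact this.congr (Filter.Eventually.of_forall fun x => real_inner_self_eq_norm_sq (F := C4) _)

theorem integrable_mul_of_bounded {α : Type*} [MeasurableSpace α] {μ : Measure α} {g h : α → ℝ}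
    (hg : Integrable g μ) (hh : Measurable h) (C : ℝ) (hC : ∀ x, |h x| ≤ C) :
    Integrable (fun x => h x * g x) μ :=
  hg.bdd_mul hh.aestronglyMeasurable (Filter.Eventually.of_forall hC)

theorem div_add_le_one {A t : ℝ} (hA : 0 ≤ A) (ht : 0 < t) : |A / (A + t)| ≤ 1 := by
  rw [abs_of_nonneg (by positivity)]
  exact div_le_one_of_le₀ (by linarith) (by positivity)

/-- The left side is the minimum of A a² + t b² over all splittings r = a + b. This variational form
transfers an inequality between forms to their resolvents, with no need for the operators to
commute. -/
theorem resolvent_mul_sq_le {A t a b r : ℝ} (hA : 0 ≤ A) (ht : 0 < t) (hr : 0 ≤ r)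
    (hab : r ≤ a + b) : t * (A / (A + t) * r ^ 2) ≤ A * a ^ 2 + t * b ^ 2 := by
  have h1 : 0 < A + t := by positivity
  have h2 : r ^ 2 ≤ (a + b) ^ 2 := by gcongr
  have h3 : t * (A / (A + t) * r ^ 2) = t * A * r ^ 2 / (A + t) := by ring
  rw [h3, div_le_iff₀ h1]
  nlinarith [sq_nonneg (A * a - t * b), mul_le_mul_of_nonneg_left h2 (mul_nonneg ht.le hA)]

/-- Comparison of the resolvents of the Hardy weight and of the Laplacian. -/
theorem resolvent_comparison {c : ℝ} (hc : 0 < c) (y : R3) {t : ℝ} (ht : 0 < t)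
    (f : 𝓢(R3, C4)) :
    ∫ x, (‖x - y‖ ^ 2 + c)⁻¹ / ((‖x - y‖ ^ 2 + c)⁻¹ + t) * ‖(𝓕⁻ f : 𝓢(R3, C4)) x‖ ^ 2 ≤
      ∫ ξ, (4 * Real.pi * ‖ξ‖) ^ 2 / ((4 * Real.pi * ‖ξ‖) ^ 2 + t) * ‖f ξ‖ ^ 2 := by
  set A : R3 → ℝ := fun x => (‖x - y‖ ^ 2 + c)⁻¹ with hA
  set B : R3 → ℝ := fun ξ => (4 * Real.pi * ‖ξ‖) ^ 2 with hB
  have hApos : ∀ x, 0 ≤ A x := fun x => by positivity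
  have hBpos : ∀ x, 0 ≤ B x := fun x => by positivity
  have hAm : Measurable A := by fun_prop
  have hBm : Measurable B := by fun_prop
  have hpi : 0 < Real.pi := Real.pi_pos
  -- The multiplier of the optimal splitting f = g + (f - g) on the Fourier side, where the minimum
  -- is attained (`hpt`). In position space the same splitting is merely admissible; Hardy bounds
  -- its first part and Plancherel the second.
  set μ : R3 → ℝ := fun ξ => t / (B ξ + t) with hμ
  have hμt : μ.HasTemperateGrowth := by
    have h := hasTemperateGrowth_inv_one_add_sq (c := t / (16 * Real.pi ^ 2)) (by positivity) 0
    have : μ = fun ξ => t / (16 * Real.pi ^ 2) * (‖ξ - 0‖ ^ 2 + t / (16 * Real.pi ^ 2))⁻¹ := by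
      funext ξ
      simp only [hμ, hB, sub_zero]
      have h1 : 0 < (4 * Real.pi * ‖ξ‖) ^ 2 + t := by positivity
      have h2 : 0 < ‖ξ‖ ^ 2 + t / (16 * Real.pi ^ 2) := by positivity
      rw [← div_eq_mul_inv, div_eq_div_iff h1.ne' h2.ne']
      field_simp
      ring
    rw [this]
    fun_prop
  set g : 𝓢(R3, C4) := SchwartzMap.smulLeftCLM C4 μ f with hg
  have hgx : ∀ ξ, g ξ = μ ξ • f ξ := fun ξ => SchwartzMap.smulLeftCLM_apply_apply hμt f ξ
  set u : 𝓢(R3, C4) := 𝓕⁻ f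
  set v : 𝓢(R3, C4) := 𝓕⁻ g
  have hFv : (𝓕 v : 𝓢(R3, C4)) = g := fourier_fourierInv_eq g
  have hFw : (𝓕 (𝓕⁻ (f - g) : 𝓢(R3, C4)) : 𝓢(R3, C4)) = f - g := fourier_fourierInv_eq _
  have hw : (𝓕⁻ (f - g) : 𝓢(R3, C4)) = u - v := map_sub (fourierInvCLM ℂ 𝓢(R3, C4)) f g
  have hH : ∫ x, A x * ‖v x‖ ^ 2 ≤ ∫ ξ, B ξ * ‖g ξ‖ ^ 2 := by
    have := hardy_fourier hc y v
    rwa [hFv] at this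
  have hP : ∫ x, ‖(u - v) x‖ ^ 2 = ∫ ξ, ‖(f - g) ξ‖ ^ 2 := by
    rw [← hw, ← SchwartzMap.integral_norm_sq_fourier, hFw]
  have hA1 : ∀ x, |A x| ≤ c⁻¹ := fun x => by
    rw [abs_of_nonneg (hApos x)]
    exact inv_anti₀ hc (by nlinarith [sq_nonneg ‖x - y‖])
  have hAv := integrable_mul_of_bounded (integrable_norm_sq_schwartz v) hAm _ hA1
  have hw2 := (integrable_norm_sq_schwartz (u - v)).const_mul t
  have hL := integrable_mul_of_bounded (integrable_norm_sq_schwartz u)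
    (h := fun x => A x / (A x + t)) (by fun_prop) 1 fun x => div_add_le_one (hApos x) ht
  have hR := integrable_mul_of_bounded (integrable_norm_sq_schwartz f)
    (h := fun x => B x / (B x + t)) (by fun_prop) 1 fun x => div_add_le_one (hBpos x) ht
  have hwf := (integrable_norm_sq_schwartz (f - g)).const_mul t
  have hpt : ∀ ξ, B ξ * ‖g ξ‖ ^ 2 + t * ‖(f - g) ξ‖ ^ 2
      = t * (B ξ / (B ξ + t) * ‖f ξ‖ ^ 2) := fun ξ => by
    have h1 : 0 < B ξ + t := by have := hBpos ξ; positivity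
    have h2 : (f - g) ξ = (1 - μ ξ) • f ξ := by
      rw [sub_apply, hgx, sub_smul, one_smul]
    rw [h2, hgx, norm_smul, norm_smul, mul_pow, mul_pow, Real.norm_eq_abs, Real.norm_eq_abs,
      sq_abs, sq_abs]
    simp only [hμ]
    field_simp
    ring
  have hBg : Integrable fun ξ => B ξ * ‖g ξ‖ ^ 2 := by
    have : (fun ξ => B ξ * ‖g ξ‖ ^ 2) = fun ξ => t * (B ξ / (B ξ + t) * ‖f ξ‖ ^ 2)
        - t * ‖(f - g) ξ‖ ^ 2 := by
      funext ξ; rw [← hpt]; ring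
    rw [this]
    exact (hR.const_mul t).sub hwf
  have key : t * ∫ x, A x / (A x + t) * ‖u x‖ ^ 2
      ≤ t * ∫ ξ, B ξ / (B ξ + t) * ‖f ξ‖ ^ 2 := by
    calc t * ∫ x, A x / (A x + t) * ‖u x‖ ^ 2
        = ∫ x, t * (A x / (A x + t) * ‖u x‖ ^ 2) := (integral_const_mul _ _).symm
      _ ≤ ∫ x, (A x * ‖v x‖ ^ 2 + t * ‖(u - v) x‖ ^ 2) := by
          refine integral_mono (hL.const_mul t) (hAv.add hw2) fun x => ?_
          refine resolvent_mul_sq_le (hApos x) ht (norm_nonneg _) ?_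
          calc ‖u x‖ = ‖v x + (u - v) x‖ := by
                rw [sub_apply, add_sub_cancel]
            _ ≤ _ := norm_add_le _ _
      _ = (∫ x, A x * ‖v x‖ ^ 2) + t * ∫ x, ‖(u - v) x‖ ^ 2 := by
          rw [integral_add hAv hw2, integral_const_mul]
      _ ≤ (∫ ξ, B ξ * ‖g ξ‖ ^ 2) + t * ∫ ξ, ‖(f - g) ξ‖ ^ 2 := by rw [hP]; gcongr
      _ = ∫ ξ, t * (B ξ / (B ξ + t) * ‖f ξ‖ ^ 2) := by
          rw [← integral_const_mul, ← integral_add hBg hwf]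
          exact integral_congr_ae (Filter.Eventually.of_forall hpt)
      _ = _ := integral_const_mul _ _
  exact le_of_mul_le_mul_left key ht

/-- The substitution s ↦ s/A reduces this to the arctangent integral. It represents the square root
of A² as a superposition of resolvents at t = s². -/
theorem lintegral_resolvent {A : ℝ} (hA : 0 ≤ A) :
    ∫⁻ s : ℝ, ENNReal.ofReal (A ^ 2 / (A ^ 2 + s ^ 2)) = ENNReal.ofReal (Real.pi * A) := by
  rcases hA.eq_or_lt with rfl | hA
  · simp
  have h : ∀ s : ℝ, A ^ 2 / (A ^ 2 + s ^ 2) = (1 + (s / A) ^ 2)⁻¹ := fun s => by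
    field_simp
  have hi : Integrable fun s : ℝ => (1 + (s / A) ^ 2)⁻¹ :=
    integrable_inv_one_add_sq.comp_div hA.ne'
  simp_rw [h]
  rw [← ofReal_integral_eq_lintegral_ofReal hi
    (Filter.Eventually.of_forall fun s => by positivity),
    Measure.integral_comp_div (fun s : ℝ => (1 + s ^ 2)⁻¹), integral_univ_inv_one_add_sq,
    abs_of_pos hA, smul_eq_mul, mul_comm]

theorem lintegral_lintegral_resolvent {A g : R3 → ℝ} (hA : ∀ x, 0 ≤ A x) (hAm : Measurable A)
    (hg : ∀ x, 0 ≤ g x) (hgm : Measurable g) :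
    ∫⁻ s : ℝ, ∫⁻ x, ENNReal.ofReal (A x ^ 2 / (A x ^ 2 + s ^ 2) * g x) =
      ENNReal.ofReal Real.pi * ∫⁻ x, ENNReal.ofReal (A x * g x) := by
  rw [lintegral_lintegral_swap (by fun_prop), ← lintegral_const_mul _ (by fun_prop)]
  congr 1
  funext x
  simp_rw [ENNReal.ofReal_mul' (hg x)]
  rw [lintegral_mul_const _ (by fun_prop), lintegral_resolvent (hA x),
    ENNReal.ofReal_mul Real.pi_pos.le, mul_assoc]

/-- Kato's inequality for Schwartz functions, with a regularized weight. -/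
theorem kato_schwartz {c : ℝ} (hc : 0 < c) (y : R3) (f : 𝓢(R3, C4)) :
    ∫⁻ x, ENNReal.ofReal (Real.sqrt (‖x - y‖ ^ 2 + c)⁻¹ * ‖(𝓕⁻ f : 𝓢(R3, C4)) x‖ ^ 2) ≤
      ∫⁻ ξ, ENNReal.ofReal (4 * Real.pi * ‖ξ‖ * ‖f ξ‖ ^ 2) := by
  have hpi : ENNReal.ofReal Real.pi ≠ 0 := by simpa using Real.pi_pos
  have hm : ∀ h : 𝓢(R3, C4), Measurable h := fun h => h.continuous.measurable
  have hmf := hm f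
  have hmu := hm (𝓕⁻ f)
  rw [← ENNReal.mul_le_mul_iff_right hpi ENNReal.ofReal_ne_top,
    ← lintegral_lintegral_resolvent (fun x => Real.sqrt_nonneg _) (by fun_prop)
      (fun x => by positivity) (by fun_prop),
    ← lintegral_lintegral_resolvent (fun x => by positivity) (by fun_prop)
      (fun x => by positivity) (by fun_prop)]
  have h0 : ∀ᵐ s : ℝ, s ≠ 0 := by simp [ae_iff]
  refine lintegral_mono_ae (h0.mono fun s hs => ?_)
  have ht : 0 < s ^ 2 := by positivity
  have hA : ∀ x : R3, 0 < (‖x - y‖ ^ 2 + c)⁻¹ := fun x => by positivity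
  have hsq : ∀ x : R3, Real.sqrt (‖x - y‖ ^ 2 + c)⁻¹ ^ 2 = (‖x - y‖ ^ 2 + c)⁻¹ := fun x =>
    Real.sq_sqrt (hA x).le
  simp_rw [hsq]
  rw [← ofReal_integral_eq_lintegral_ofReal, ← ofReal_integral_eq_lintegral_ofReal]
  · exact ENNReal.ofReal_le_ofReal (resolvent_comparison hc y ht f)
  · exact integrable_mul_of_bounded (integrable_norm_sq_schwartz f) (by fun_prop) 1
      fun x => div_add_le_one (by positivity) ht
  · exact Filter.Eventually.of_forall fun x => by positivity
  · exact integrable_mul_of_bounded (integrable_norm_sq_schwartz (𝓕⁻ f)) (by fun_prop) 1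
      fun x => div_add_le_one (hA x).le ht
  · exact Filter.Eventually.of_forall fun x => by positivity

/-! ### Extension of Kato's inequality from Schwartz functions to H^{1/2}. -/

theorem integral_norm_sq (F : L2) : ∫ x, ‖F x‖ ^ 2 = ‖F‖ ^ 2 := by
  have h := L2.inner_def (𝕜 := ℂ) F F
  simp_rw [inner_self_eq_norm_sq_to_K] at h
  have h2 : ∫ x, ((‖F x‖ : ℂ)) ^ 2 = ((∫ x, ‖F x‖ ^ 2 : ℝ) : ℂ) := by
    rw [← integral_complex_ofReal]; push_cast; rfl
  have h3 : ((‖F‖ ^ 2 : ℝ) : ℂ) = ((∫ x, ‖F x‖ ^ 2 : ℝ) : ℂ) := by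
    rw [Complex.ofReal_pow]; exact h.trans h2
  exact (Complex.ofReal_injective h3).symm

theorem integrable_norm_sq (F : L2) : Integrable fun x => ‖F x‖ ^ 2 :=
  (Lp.memLp F).integrable_norm_pow (by norm_num)

theorem lintegral_norm_sq (F : L2) :
    ∫⁻ x, ENNReal.ofReal (‖F x‖ ^ 2) = ENNReal.ofReal (‖F‖ ^ 2) := by
  rw [← integral_norm_sq, ofReal_integral_eq_lintegral_ofReal (integrable_norm_sq F)
    (Filter.Eventually.of_forall fun x => by positivity)]

/-- Multiplication by a bounded function on `L²`. -/
noncomputable def mulL {b : R3 → ℝ} (hb : MemLp b ∞ volume) : L2 →L[ℝ] L2 :=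
  (ContinuousLinearMap.lsmul ℝ ℝ).holderL volume ∞ 2 2 (hb.toLp b)

theorem coeFn_mulL {b : R3 → ℝ} (hb : MemLp b ∞ volume) (F : L2) :
    mulL hb F =ᵐ[volume] fun x => b x • F x := by
  have h := (ContinuousLinearMap.lsmul ℝ ℝ (E := C4)).coeFn_holder (r := 2) (hb.toLp b) F
  filter_upwards [h, hb.coeFn_toLp] with x h1 h2
  rw [← h2]
  exact h1

theorem lintegral_mulL {b : R3 → ℝ} (hb : MemLp b ∞ volume) (F : L2) :
    ∫⁻ x, ENNReal.ofReal (b x ^ 2 * ‖F x‖ ^ 2) = ENNReal.ofReal (‖mulL hb F‖ ^ 2) := by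
  rw [← lintegral_norm_sq]
  refine lintegral_congr_ae ((coeFn_mulL hb F).mono fun x hx => ?_)
  simp only [hx, norm_smul, mul_pow, Real.norm_eq_abs, sq_abs]

theorem memLp_top_of_abs_le {b : R3 → ℝ} (hb : Measurable b) (C : ℝ) (hC : ∀ x, |b x| ≤ C) :
    MemLp b ∞ volume :=
  memLp_top_of_bound hb.aestronglyMeasurable C (Filter.Eventually.of_forall hC)

/-- The symbol of the Bessel potential of order `-1/2`. -/
noncomputable def besselSymbol (ξ : R3) : ℝ := (1 + ‖ξ‖ ^ 2) ^ (-(1 / 4) : ℝ)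

theorem besselSymbol_pos (ξ : R3) : 0 < besselSymbol ξ := by unfold besselSymbol; positivity

theorem besselSymbol_le_one (ξ : R3) : besselSymbol ξ ≤ 1 :=
  Real.rpow_le_one_of_one_le_of_nonpos (by nlinarith [sq_nonneg ‖ξ‖]) (by norm_num)

theorem measurable_besselSymbol : Measurable besselSymbol := by unfold besselSymbol; fun_prop

theorem memLp_besselSymbol : MemLp besselSymbol ∞ volume :=
  memLp_top_of_abs_le measurable_besselSymbol 1 fun ξ => by
    rw [abs_of_pos (besselSymbol_pos ξ)]; exact besselSymbol_le_one ξ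

theorem besselSymbol_sq (ξ : R3) : besselSymbol ξ ^ 2 = (Real.sqrt (1 + ‖ξ‖ ^ 2))⁻¹ := by
  have : 0 ≤ 1 + ‖ξ‖ ^ 2 := by positivity
  rw [besselSymbol, Real.sqrt_eq_rpow, ← Real.rpow_neg this, ← Real.rpow_natCast,
    ← Real.rpow_mul this]
  norm_num

theorem norm_mul_besselSymbol_sq_le (ξ : R3) : ‖ξ‖ * besselSymbol ξ ^ 2 ≤ 1 := by
  rw [besselSymbol_sq, ← div_eq_mul_inv]
  exact div_le_one_of_le₀ (Real.le_sqrt_of_sq_le (by linarith)) (Real.sqrt_nonneg _)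

/-- `ψ` has the form `(1 + |ξ|²)^(-1/4) G` on the Fourier side, with `G ∈ L²`. -/
def HalfRegular (ψ : L2) : Prop :=
  ∃ G : L2, ∀ᵐ ξ, (𝓕 ψ : L2) ξ = besselSymbol ξ • G ξ

/-- Sobolev membership gives G ∈ L² equal, as a distribution, to (1+|ξ|²)^{1/4} times the Fourier
transform of ψ. Multiplying by the inverse symbol and using injectivity of L² into tempered
distributions gives the almost-everywhere identity. -/
theorem halfRegular_of_mem_X {ψ : L2} (h : ψ ∈ X) : HalfRegular ψ := by
  obtain ⟨G, hG⟩ := TemperedDistribution.memSobolev_iff_exists_smulLeftCLM_fourier.1 h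
  refine ⟨G, ?_⟩
  set b : R3 → ℂ := fun x => (((1 + ‖x‖ ^ 2) ^ (-(1 / 4) : ℝ) : ℝ) : ℂ) with hb
  have hbt : b.HasTemperateGrowth := by fun_prop
  have hbL : MemLp b ∞ volume := memLp_besselSymbol.ofReal
  have h1 := Lp.toTemperedDistribution_smul_eq (r := 2) hbt hbL G
  rw [← hG, TemperedDistribution.smulLeftCLM_smulLeftCLM_apply (by fun_prop) hbt] at h1
  have h2 : (fun x : R3 => (((1 + ‖x‖ ^ 2) ^ ((1 / 2 : ℝ) / 2) : ℝ) : ℂ)) * b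
      = fun _ => (1 : ℂ) := by
    funext x
    simp only [Pi.mul_apply, hb]
    norm_cast
    rw [← Real.rpow_add (by positivity)]
    norm_num
  rw [h2, TemperedDistribution.smulLeftCLM_const, one_smul,
    Lp.fourier_toTemperedDistribution_eq] at h1
  have h3 := LinearMap.ker_eq_bot.1
    (Lp.ker_toTemperedDistributionCLM_eq_bot (F := C4) (μ := (volume : Measure R3)) (p := 2)) h1
  rw [← h3]
  filter_upwards [Lp.coeFn_lpSMul (r := 2) (hbL.toLp b) G, hbL.coeFn_toLp] with ξ h4 h5
  rw [h4, Pi.smul_apply', h5, hb, besselSymbol, Complex.coe_smul]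

/-- The matrix symbol is bounded and commutes with the scalar Bessel factor, so it can be applied to
G. -/
theorem halfRegular_energyProj {m ε : ℝ} {ψ : L2} (h : HalfRegular ψ) :
    HalfRegular (energyProj m ε ψ) := by
  obtain ⟨G, hG⟩ := h
  refine ⟨(memLp_projSymbol m ε G).toLp _, ?_⟩
  unfold energyProj
  rw [fourier_fourierInv_eq]
  filter_upwards [hG, (memLp_projSymbol m ε G).coeFn_toLp,
    (memLp_projSymbol m ε (𝓕 ψ)).coeFn_toLp] with ξ h1 h2 h3
  rw [h2, h3, h1, ← Complex.coe_smul, ← Complex.coe_smul, map_smul]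

/-- Kato's inequality in `H^{1/2}`, with a regularized weight. -/
theorem kato_regularized {c : ℝ} (hc : 0 < c) (y : R3) {ψ : L2} (h : HalfRegular ψ) :
    ∫⁻ x, ENNReal.ofReal (Real.sqrt (‖x - y‖ ^ 2 + c)⁻¹ * ‖ψ x‖ ^ 2) ≤
      ∫⁻ ξ, ENNReal.ofReal (4 * Real.pi * ‖ξ‖ * ‖(𝓕 ψ : L2) ξ‖ ^ 2) := by
  obtain ⟨G, hG⟩ := h
  have hpi := Real.pi_pos
  set α : R3 → ℝ := fun x => Real.sqrt (Real.sqrt (‖x - y‖ ^ 2 + c)⁻¹) with hα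
  have hα2 : ∀ x, α x ^ 2 = Real.sqrt (‖x - y‖ ^ 2 + c)⁻¹ := fun x =>
    Real.sq_sqrt (Real.sqrt_nonneg _)
  have hαL : MemLp α ∞ volume := memLp_top_of_abs_le (by fun_prop) (Real.sqrt (Real.sqrt c⁻¹))
    fun x => by
      rw [abs_of_nonneg (Real.sqrt_nonneg _)]
      gcongr
      nlinarith [sq_nonneg ‖x - y‖]
  set d : R3 → ℝ := fun ξ => Real.sqrt (4 * Real.pi * ‖ξ‖) * besselSymbol ξ with hd
  have hbm := measurable_besselSymbol
  have hd2 : ∀ ξ, d ξ ^ 2 = 4 * Real.pi * (‖ξ‖ * besselSymbol ξ ^ 2) := fun ξ => by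
    simp only [hd, mul_pow]
    rw [Real.sq_sqrt (by positivity), mul_assoc _ ‖ξ‖]
  have hdL : MemLp d ∞ volume := memLp_top_of_abs_le (by fun_prop) (Real.sqrt (4 * Real.pi))
    fun ξ => Real.abs_le_sqrt <| by
      rw [hd2]
      nlinarith [norm_mul_besselSymbol_sq_le ξ]
  have hF : (𝓕 ψ : L2) = mulL memLp_besselSymbol G := by
    refine Lp.ext ?_
    filter_upwards [hG, coeFn_mulL memLp_besselSymbol G] with ξ h1 h2
    rw [h1, h2]
  have hψ : ψ = 𝓕⁻ (mulL memLp_besselSymbol G) := by rw [← hF, fourierInv_fourier_eq]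
  have hR : ∀ G : L2, ∫⁻ ξ, ENNReal.ofReal (4 * Real.pi * ‖ξ‖ * ‖(mulL memLp_besselSymbol G) ξ‖ ^ 2)
      = ENNReal.ofReal (‖mulL hdL G‖ ^ 2) := fun G => by
    rw [← lintegral_mulL]
    refine lintegral_congr_ae ((coeFn_mulL memLp_besselSymbol G).mono fun ξ hξ => ?_)
    simp only [hξ, hd2, norm_smul, mul_pow, Real.norm_eq_abs, sq_abs]
    congr 1
    ring
  rw [hF, hR]
  simp_rw [← hα2]
  rw [lintegral_mulL hαL, hψ]
  refine ENNReal.ofReal_le_ofReal ?_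
  -- Written in terms of G, both sides are squared norms of bounded operators: c > 0 bounds the
  -- weight and the Bessel factor absorbs √|ξ|. The inequality is thus a closed condition, and
  -- Schwartz functions suffice.
  refine DenseRange.induction_on (p := fun G : L2 =>
      ‖mulL hαL (𝓕⁻ (mulL memLp_besselSymbol G))‖ ^ 2 ≤ ‖mulL hdL G‖ ^ 2)
    (SchwartzMap.denseRange_toLpCLM (F := C4) (μ := (volume : Measure R3)) (p := 2) (by norm_num))
    G ?_ fun f => ?_
  · have hc1 : Continuous fun G : L2 => (𝓕⁻ (mulL memLp_besselSymbol G) : L2) :=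
      (Lp.fourierTransformₗᵢ R3 C4).symm.continuous.comp (mulL memLp_besselSymbol).continuous
    exact isClosed_le (((mulL hαL).continuous.comp hc1).norm.pow 2)
      ((mulL hdL).continuous.norm.pow 2)
  · rw [SchwartzMap.toLpCLM_apply]
    have hbt : besselSymbol.HasTemperateGrowth :=
      Function.hasTemperateGrowth_one_add_norm_sq_rpow R3 _
    set g : 𝓢(R3, C4) := SchwartzMap.smulLeftCLM C4 besselSymbol f with hg
    have hgL : mulL memLp_besselSymbol (f.toLp 2) = g.toLp 2 := by
      refine Lp.ext ?_
      filter_upwards [coeFn_mulL memLp_besselSymbol (f.toLp 2), f.coeFn_toLp 2 volume,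
        g.coeFn_toLp 2 volume] with ξ h1 h2 h3
      rw [h1, h2, h3, hg, SchwartzMap.smulLeftCLM_apply_apply hbt]
    have hk := kato_schwartz hc y g
    rw [← ENNReal.ofReal_le_ofReal_iff (by positivity), ← hR, ← lintegral_mulL, hgL,
      SchwartzMap.toLp_fourierInv_eq]
    refine (le_of_eq ?_).trans (hk.trans_eq ?_)
    · refine lintegral_congr_ae (((𝓕⁻ g).coeFn_toLp 2 volume).mono fun x hx => ?_)
      simp only [hx, hα2]
    · refine lintegral_congr_ae ((g.coeFn_toLp 2 volume).mono fun x hx => ?_)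
      simp only [hx]

/-- The right side does not depend on the regularization, so Fatou's lemma along c = 1/(n+1) removes
it. -/
theorem kato_fourier (y : R3) {ψ : L2} (h : HalfRegular ψ) :
    ∫⁻ x, ENNReal.ofReal (‖ψ x‖ ^ 2 / ‖x - y‖) ≤
      ∫⁻ ξ, ENNReal.ofReal (4 * Real.pi * ‖ξ‖ * ‖(𝓕 ψ : L2) ξ‖ ^ 2) := by
  have hm : AEMeasurable (fun x => ‖ψ x‖) volume := (Lp.aestronglyMeasurable ψ).norm.aemeasurable
  set F : ℕ → R3 → ℝ≥0∞ := fun n x =>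
    ENNReal.ofReal (Real.sqrt (‖x - y‖ ^ 2 + 1 / ((n : ℝ) + 1))⁻¹ * ‖ψ x‖ ^ 2) with hF
  have hlim : ∀ᵐ x, Filter.liminf (fun n => F n x) Filter.atTop
      = ENNReal.ofReal (‖ψ x‖ ^ 2 / ‖x - y‖) := by
    have h0 : ∀ᵐ x : R3, x ≠ y := by simp [ae_iff]
    refine h0.mono fun x hx => Filter.Tendsto.liminf_eq ?_
    have hn : 0 < ‖x - y‖ := norm_pos_iff.2 (sub_ne_zero.2 hx)
    refine ENNReal.tendsto_ofReal ?_
    have h1 : Filter.Tendsto (fun n : ℕ => ‖x - y‖ ^ 2 + 1 / ((n : ℝ) + 1)) Filter.atTop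
        (nhds (‖x - y‖ ^ 2)) := by
      simpa using tendsto_one_div_add_atTop_nhds_zero_nat.const_add (‖x - y‖ ^ 2)
    have h2 := ((h1.inv₀ (by positivity)).sqrt).mul_const (‖ψ x‖ ^ 2)
    rw [Real.sqrt_inv, Real.sqrt_sq hn.le, inv_mul_eq_div] at h2
    exact h2
  rw [← lintegral_congr_ae hlim]
  refine (lintegral_liminf_le' fun n => by fun_prop).trans ?_
  refine Filter.liminf_le_of_le (by isBoundedDefault) fun b hb => ?_
  obtain ⟨n, hn⟩ := hb.exists
  exact hn.trans (kato_regularized (by positivity) y h)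

/-! ### Energy forms in the momentum variable p = 2πξ. -/

theorem norm_hat_sq (ψ : L2) (p : R3) :
    ‖hat ψ p‖ ^ 2 = ((2 * Real.pi) ^ 3)⁻¹ * ‖(𝓕 ψ : L2) ((2 * Real.pi)⁻¹ • p)‖ ^ 2 := by
  have hpi : 0 < 2 * Real.pi := by positivity
  have h : ((2 * Real.pi) ^ (-(3 / 2) : ℝ)) ^ 2 = ((2 * Real.pi) ^ 3)⁻¹ := by
    rw [← Real.rpow_natCast, ← Real.rpow_mul hpi.le, ← Real.rpow_natCast, ← Real.rpow_neg hpi.le]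
    norm_num
  rw [hat, norm_smul, mul_pow, Real.norm_eq_abs, sq_abs, h]

theorem aestronglyMeasurable_hat (ψ : L2) : AEStronglyMeasurable (hat ψ) volume := by
  unfold hat
  exact ((Lp.aestronglyMeasurable (𝓕 ψ : L2)).comp_quasiMeasurePreserving
    quasiMeasurePreserving_rescale).const_smul ((2 * Real.pi) ^ (-(3 / 2) : ℝ) : ℝ)

/-- Change of variables `p = 2πξ` between `hat` and `𝓕`. -/
theorem lintegral_hat (ψ : L2) (φ : R3 → ℝ) :
    ∫⁻ p, ENNReal.ofReal (φ p * ‖hat ψ p‖ ^ 2) =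
      ∫⁻ ξ, ENNReal.ofReal (φ ((2 * Real.pi) • ξ) * ‖(𝓕 ψ : L2) ξ‖ ^ 2) := by
  have hpi : 0 < 2 * Real.pi := by positivity
  set r : ℝ := (2 * Real.pi)⁻¹ with hr
  have hr0 : r ≠ 0 := by positivity
  have hrp : 0 < r := by positivity
  have hme : MeasurableEmbedding fun p : R3 => r • p :=
    (Homeomorph.smulOfNeZero r hr0).measurableEmbedding
  have h1 := hme.lintegral_map (μ := volume)
    fun ξ : R3 => ENNReal.ofReal (φ ((2 * Real.pi) • ξ) * ‖(𝓕 ψ : L2) ξ‖ ^ 2)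
  rw [Measure.map_addHaar_smul volume hr0, lintegral_smul_measure, finrank_euclideanSpace_fin]
    at h1
  have h2 : ∀ p : R3, ENNReal.ofReal (φ p * ‖hat ψ p‖ ^ 2) = ENNReal.ofReal (r ^ 3) *
      ENNReal.ofReal (φ ((2 * Real.pi) • r • p) * ‖(𝓕 ψ : L2) (r • p)‖ ^ 2) := fun p => by
    rw [← ENNReal.ofReal_mul (by positivity), norm_hat_sq, hr, smul_inv_smul₀ hpi.ne', inv_pow]
    congr 1
    ring
  simp_rw [h2]
  rw [lintegral_const_mul' _ _ ENNReal.ofReal_ne_top, ← h1, smul_eq_mul, ← mul_assoc,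
    ← ENNReal.ofReal_mul (by positivity), abs_of_pos (by positivity),
    mul_inv_cancel₀ (by positivity), ENNReal.ofReal_one, one_mul]

theorem lam_nonneg (m : ℝ) (p : R3) : 0 ≤ lam m p := Real.sqrt_nonneg _

theorem norm_le_lam (m : ℝ) (p : R3) : ‖p‖ ≤ lam m p :=
  Real.le_sqrt_of_sq_le (by nlinarith [sq_nonneg m])

theorem le_lam (m : ℝ) (p : R3) : m ≤ lam m p :=
  Real.le_sqrt_of_sq_le (by nlinarith [sq_nonneg ‖p‖])

theorem lam_le {m : ℝ} (hm : 0 ≤ m) (p : R3) : lam m p ≤ ‖p‖ + m :=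
  Real.sqrt_le_iff.2 ⟨by positivity, by nlinarith [mul_nonneg (norm_nonneg p) hm]⟩

theorem integrable_hat_sq (ψ : L2) : Integrable fun p => ‖hat ψ p‖ ^ 2 := by
  refine ⟨((aestronglyMeasurable_hat ψ).norm.pow 2), ?_⟩
  rw [hasFiniteIntegral_iff_ofReal (Filter.Eventually.of_forall fun p => by positivity)]
  have := lintegral_hat ψ fun _ => 1
  simp only [one_mul] at this
  rw [this, lintegral_norm_sq]
  exact ENNReal.ofReal_lt_top

theorem integral_hat_sq (ψ : L2) : ∫ p, ‖hat ψ p‖ ^ 2 = ‖ψ‖ ^ 2 := by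
  have := lintegral_hat ψ fun _ => 1
  simp only [one_mul] at this
  rw [lintegral_norm_sq, ← ofReal_integral_eq_lintegral_ofReal (integrable_hat_sq ψ)
    (Filter.Eventually.of_forall fun p => by positivity), Lp.norm_fourier_eq] at this
  exact (ENNReal.ofReal_eq_ofReal_iff (integral_nonneg fun p => by positivity)
    (by positivity)).1 this

theorem integrable_lam_mul {m : ℝ} (hm : 0 ≤ m) {ψ : L2} (h : HalfRegular ψ) :
    Integrable fun p => lam m p * ‖hat ψ p‖ ^ 2 := by
  obtain ⟨G, hG⟩ := h
  refine ⟨(measurable_lam m).aestronglyMeasurable.mul ((aestronglyMeasurable_hat ψ).norm.pow 2), ?_⟩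
  rw [hasFiniteIntegral_iff_ofReal (Filter.Eventually.of_forall fun p =>
    mul_nonneg (lam_nonneg m _) (by positivity)), lintegral_hat]
  have hle : ∫⁻ ξ, ENNReal.ofReal (lam m ((2 * Real.pi) • ξ) * ‖(𝓕 ψ : L2) ξ‖ ^ 2) ≤
      ∫⁻ ξ, ENNReal.ofReal (2 * Real.pi + m) * ENNReal.ofReal (‖G ξ‖ ^ 2) := by
    refine lintegral_mono_ae (hG.mono fun ξ hξ => ?_)
    have hpi : 0 < 2 * Real.pi := by positivity
    rw [← ENNReal.ofReal_mul (by positivity), hξ, norm_smul, mul_pow, Real.norm_eq_abs, sq_abs,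
      ← mul_assoc]
    refine ENNReal.ofReal_le_ofReal (mul_le_mul_of_nonneg_right ?_ (by positivity))
    have h1 := lam_le hm ((2 * Real.pi) • ξ)
    rw [norm_smul, Real.norm_eq_abs, abs_of_pos hpi] at h1
    have h2 := norm_mul_besselSymbol_sq_le ξ
    have h3 : besselSymbol ξ ^ 2 ≤ 1 := pow_le_one₀ (besselSymbol_pos ξ).le (besselSymbol_le_one ξ)
    nlinarith [mul_le_mul_of_nonneg_right h1 (sq_nonneg (besselSymbol ξ))]
  refine hle.trans_lt ?_
  rw [lintegral_const_mul' _ _ ENNReal.ofReal_ne_top, lintegral_norm_sq]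
  exact ENNReal.mul_lt_top ENNReal.ofReal_lt_top ENNReal.ofReal_lt_top

/-- The quadratic form of `√(-Δ)`. -/
noncomputable def momentumForm (ψ : L2) : ℝ := ∫ p : R3, ‖p‖ * ‖hat ψ p‖ ^ 2

theorem momentumForm_nonneg (ψ : L2) : 0 ≤ momentumForm ψ :=
  integral_nonneg fun p => by positivity

theorem integrable_norm_mul {ψ : L2} (h : HalfRegular ψ) :
    Integrable fun p => ‖p‖ * ‖hat ψ p‖ ^ 2 := by
  simpa [lam] using integrable_lam_mul le_rfl h

theorem hNorm_sq (m : ℝ) (ψ : L2) : hNorm m ψ ^ 2 = ∫ p : R3, lam m p * ‖hat ψ p‖ ^ 2 :=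
  Real.sq_sqrt (integral_nonneg fun p => mul_nonneg (lam_nonneg m _) (by positivity))

theorem momentumForm_le {m : ℝ} (hm : 0 ≤ m) {ψ : L2} (h : HalfRegular ψ) :
    momentumForm ψ ≤ hNorm m ψ ^ 2 := by
  rw [hNorm_sq]
  exact integral_mono (integrable_norm_mul h) (integrable_lam_mul hm h) fun p =>
    mul_le_mul_of_nonneg_right (norm_le_lam m p) (by positivity)

theorem mass_mul_le {m : ℝ} (hm : 0 ≤ m) {ψ : L2} (h : HalfRegular ψ) :
    m * ‖ψ‖ ^ 2 ≤ hNorm m ψ ^ 2 := by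
  rw [hNorm_sq, ← integral_hat_sq, ← integral_const_mul]
  exact integral_mono ((integrable_hat_sq ψ).const_mul m) (integrable_lam_mul hm h) fun p =>
    mul_le_mul_of_nonneg_right (le_lam m p) (by positivity)

/-- Since |p|² = (λ-m)(λ+m), the arithmetic-geometric mean inequality gives s|p| ≤ ½((λ-m) +
s²(λ+m)); integrate this against |ψ̂|². -/
theorem mul_momentumForm_le {m : ℝ} (hm : 0 ≤ m) {ψ : L2} (h : HalfRegular ψ) (s : ℝ) :
    s * momentumForm ψ ≤ 1 / 2 * ((hNorm m ψ ^ 2 - m * ‖ψ‖ ^ 2)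
      + s ^ 2 * (hNorm m ψ ^ 2 + m * ‖ψ‖ ^ 2)) := by
  have hl := integrable_lam_mul hm h
  have hn := integrable_hat_sq ψ
  have e : 1 / 2 * ((hNorm m ψ ^ 2 - m * ‖ψ‖ ^ 2) + s ^ 2 * (hNorm m ψ ^ 2 + m * ‖ψ‖ ^ 2))
      = ∫ p, ((1 + s ^ 2) / 2 * (lam m p * ‖hat ψ p‖ ^ 2)
        + (s ^ 2 - 1) / 2 * m * ‖hat ψ p‖ ^ 2) := by
    rw [integral_add (hl.const_mul _) (hn.const_mul _), integral_const_mul, integral_const_mul,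
      integral_hat_sq, hNorm_sq]
    ring
  rw [e, momentumForm, ← integral_const_mul]
  refine integral_mono ((integrable_norm_mul h).const_mul s)
    ((hl.const_mul _).add (hn.const_mul _)) fun p => ?_
  have h1 : lam m p ^ 2 = ‖p‖ ^ 2 + m ^ 2 := Real.sq_sqrt (by positivity)
  have h2 : 0 ≤ lam m p - m := sub_nonneg.2 (le_lam m p)
  have h3 : s * ‖p‖ ≤ (1 + s ^ 2) / 2 * lam m p + (s ^ 2 - 1) / 2 * m := by
    refine abs_le_of_sq_le_sq' (a := s * ‖p‖) ?_ ?_ |>.2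
    · nlinarith [sq_nonneg ((lam m p - m) - s ^ 2 * (lam m p + m))]
    · nlinarith [mul_nonneg (sq_nonneg s) (add_nonneg (hm.trans (le_lam m p)) hm)]
  have := mul_le_mul_of_nonneg_right h3 (sq_nonneg ‖hat ψ p‖)
  simp only
  nlinarith

/-- Kato's inequality `|x - y|⁻¹ ≤ 2 √(-Δ)`. -/
theorem kato (y : R3) {ψ : L2} (h : HalfRegular ψ) :
    ∫⁻ x, ENNReal.ofReal (‖ψ x‖ ^ 2 / ‖x - y‖) ≤ ENNReal.ofReal (2 * momentumForm ψ) := by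
  refine (kato_fourier y h).trans_eq ?_
  rw [momentumForm, ← integral_const_mul,
    ofReal_integral_eq_lintegral_ofReal ((integrable_norm_mul h).const_mul 2)
      (Filter.Eventually.of_forall fun p => by positivity)]
  simp_rw [← mul_assoc]
  rw [lintegral_hat ψ fun p => 2 * ‖p‖]
  congr 1
  funext ξ
  rw [norm_smul, Real.norm_eq_abs, abs_of_pos (by positivity)]
  congr 1
  ring

/-! ### Coulomb pair energies. -/

/-- The integrand `|u(x)|² |v(y)|² / |x - y|`. -/
noncomputable def pairIntegrand (u v : L2) (z : R3 × R3) : ℝ :=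
  ‖u z.1‖ ^ 2 * ‖v z.2‖ ^ 2 / ‖z.1 - z.2‖

theorem pairIntegrand_nonneg (u v : L2) (z : R3 × R3) : 0 ≤ pairIntegrand u v z := by
  unfold pairIntegrand; positivity

theorem aemeasurable_pairIntegrand (u v : L2) :
    AEMeasurable (pairIntegrand u v) (volume.prod volume) := by
  have hu : AEMeasurable (fun z : R3 × R3 => ‖u z.1‖) (volume.prod volume) :=
    (Lp.aestronglyMeasurable u).norm.aemeasurable.comp_quasiMeasurePreserving
      Measure.quasiMeasurePreserving_fst
  have hv : AEMeasurable (fun z : R3 × R3 => ‖v z.2‖) (volume.prod volume) :=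
    (Lp.aestronglyMeasurable v).norm.aemeasurable.comp_quasiMeasurePreserving
      Measure.quasiMeasurePreserving_snd
  unfold pairIntegrand
  fun_prop

/-- Kato's bound is uniform in y, so the x-integral is done first and |v(y)|² integrates to ‖v‖².
With the symmetry of the pair energy, either factor may carry the momentum form. -/
theorem lintegral_pairIntegrand_le {u : L2} (hu : HalfRegular u) (v : L2) :
    ∫⁻ z, ENNReal.ofReal (pairIntegrand u v z) ≤
      ENNReal.ofReal (2 * momentumForm u * ‖v‖ ^ 2) := by
  rw [Measure.volume_eq_prod, lintegral_prod_symm _ (aemeasurable_pairIntegrand u v).ennreal_ofReal,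
    ENNReal.ofReal_mul (by have := momentumForm_nonneg u; positivity), ← lintegral_norm_sq v,
    ← lintegral_const_mul' _ _ ENNReal.ofReal_ne_top]
  refine lintegral_mono fun y => ?_
  have h : ∀ x, ENNReal.ofReal (pairIntegrand u v (x, y)) =
      ENNReal.ofReal (‖u x‖ ^ 2 / ‖x - y‖) * ENNReal.ofReal (‖v y‖ ^ 2) := fun x => by
    rw [← ENNReal.ofReal_mul (by positivity), pairIntegrand]
    congr 1
    ring
  simp_rw [h]
  rw [lintegral_mul_const' _ _ ENNReal.ofReal_ne_top]
  gcongr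
  exact kato y hu

theorem integrable_pairIntegrand {u : L2} (hu : HalfRegular u) (v : L2) :
    Integrable (pairIntegrand u v) := by
  refine ⟨(aemeasurable_pairIntegrand u v).aestronglyMeasurable, ?_⟩
  rw [hasFiniteIntegral_iff_ofReal (Filter.Eventually.of_forall (pairIntegrand_nonneg u v))]
  exact (lintegral_pairIntegrand_le hu v).trans_lt ENNReal.ofReal_lt_top

theorem integral_pairIntegrand_le {u : L2} (hu : HalfRegular u) (v : L2) :
    ∫ z, pairIntegrand u v z ≤ 2 * momentumForm u * ‖v‖ ^ 2 := by
  have h := lintegral_pairIntegrand_le hu v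
  rw [← ofReal_integral_eq_lintegral_ofReal (integrable_pairIntegrand hu v)
    (Filter.Eventually.of_forall (pairIntegrand_nonneg u v))] at h
  exact (ENNReal.ofReal_le_ofReal_iff (by have := momentumForm_nonneg u; positivity)).1 h

theorem integral_pairIntegrand_comm (u v : L2) :
    ∫ z, pairIntegrand u v z = ∫ z, pairIntegrand v u z := by
  rw [Measure.volume_eq_prod, ← integral_prod_swap]
  congr 1
  funext z
  simp only [pairIntegrand, Prod.fst_swap, Prod.snd_swap, norm_sub_rev z.2 z.1]
  ring

theorem halfRegular_smul_add {u v : L2} (hu : HalfRegular u) (hv : HalfRegular v) (c : ℂ) :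
    HalfRegular (c • u + v) := by
  obtain ⟨G, hG⟩ := hu
  obtain ⟨K, hK⟩ := hv
  refine ⟨c • G + K, ?_⟩
  have e : (𝓕 (c • u + v) : L2) = c • (𝓕 u : L2) + (𝓕 v : L2) := by
    rw [FourierAdd.fourier_add, FourierSMul.fourier_smul]
  rw [e]
  filter_upwards [hG, hK, Lp.coeFn_add (c • (𝓕 u : L2)) (𝓕 v : L2), Lp.coeFn_smul c (𝓕 u : L2),
    Lp.coeFn_add (c • G) K, Lp.coeFn_smul c G] with ξ h1 h2 h3 h4 h5 h6
  rw [h3, h5, Pi.add_apply, Pi.add_apply, h4, h6, Pi.smul_apply, Pi.smul_apply, h1, h2, smul_add,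
    smul_comm]

/-! ### Expansion of the β-density and its Coulomb energy. -/

/-- The quadratic form of `β`. -/
noncomputable def betaForm (v w : C4) : ℝ := (inner ℂ v (act beta w)).re

theorem act_beta_apply (v : C4) :
    act beta v 0 = v 0 ∧ act beta v 1 = v 1 ∧ act beta v 2 = -v 2 ∧ act beta v 3 = -v 3 := by
  refine ⟨?_, ?_, ?_, ?_⟩ <;>
  simp [act, Matrix.ofLp_toEuclideanCLM, beta, ofBlocks, Matrix.mulVec, dotProduct,
    Fin.sum_univ_four, finSumFinEquiv, Fin.addCases]

theorem norm_act_beta (v : C4) : ‖act beta v‖ = ‖v‖ := by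
  obtain ⟨h0, h1, h2, h3⟩ := act_beta_apply v
  rw [EuclideanSpace.norm_eq, EuclideanSpace.norm_eq, Fin.sum_univ_four, Fin.sum_univ_four,
    h0, h1, h2, h3, norm_neg, norm_neg]

theorem abs_betaForm_le (v w : C4) : |betaForm v w| ≤ ‖v‖ * ‖w‖ := by
  rw [← norm_act_beta w]
  exact (Complex.abs_re_le_norm _).trans (norm_inner_le_norm _ _)

theorem betaForm_comm (v w : C4) : betaForm v w = betaForm w v := by
  obtain ⟨h0, h1, h2, h3⟩ := act_beta_apply v
  obtain ⟨k0, k1, k2, k3⟩ := act_beta_apply w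
  simp only [betaForm, PiLp.inner_apply, Fin.sum_univ_four, h0, h1, h2, h3, k0, k1, k2, k3]
  simp
  ring

theorem betaForm_smul_add (a : ℝ) (v w : C4) :
    betaForm ((a : ℂ) • v + w) ((a : ℂ) • v + w) =
      a ^ 2 * betaForm v v + betaForm w w + 2 * a * betaForm v w := by
  have h := betaForm_comm w v
  simp only [betaForm] at h ⊢
  simp only [map_add, map_smul, inner_add_left, inner_add_right, inner_smul_left,
    inner_smul_right, Complex.add_re, Complex.conj_ofReal, Complex.re_ofReal_mul, h]
  ring

theorem abs_coulombIntegrand_le (ψ : L2) (z : R3 × R3) :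
    |coulombIntegrand ψ z| ≤ pairIntegrand ψ ψ z := by
  have h : ∀ x, |density ψ x| ≤ ‖ψ x‖ ^ 2 := fun x => by
    rw [sq]; exact abs_betaForm_le (ψ x) (ψ x)
  rw [coulombIntegrand, pairIntegrand, abs_div, abs_mul, abs_of_nonneg (norm_nonneg (z.1 - z.2))]
  have h1 := h z.1
  have h2 := h z.2
  gcongr

theorem integrable_coulombIntegrand {ψ : L2} (h : HalfRegular ψ) :
    Integrable (coulombIntegrand ψ) := by
  refine (integrable_pairIntegrand h ψ).mono' ?_
    (Filter.Eventually.of_forall (abs_coulombIntegrand_le ψ))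
  have hd : AEMeasurable (density ψ) volume :=
    (Complex.continuous_re.comp_aestronglyMeasurable ((Lp.aestronglyMeasurable ψ).inner
      ((act beta).continuous.comp_aestronglyMeasurable (Lp.aestronglyMeasurable ψ)))).aemeasurable
  have h1 : AEMeasurable (fun z : R3 × R3 => density ψ z.1) (volume.prod volume) :=
    hd.comp_quasiMeasurePreserving Measure.quasiMeasurePreserving_fst
  have h2 : AEMeasurable (fun z : R3 × R3 => density ψ z.2) (volume.prod volume) :=
    hd.comp_quasiMeasurePreserving Measure.quasiMeasurePreserving_snd
  have h3 : AEMeasurable (coulombIntegrand ψ) (volume.prod volume) := by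
    unfold coulombIntegrand; fun_prop
  exact h3.aestronglyMeasurable

/-- Of the nine products only AA' is kept. AB', BA' and 4CC' produce the coefficient 3a²; the terms
of order a³ and a, odd in η, are split by 2xy ≤ s x² + τ y² with τ = 1/s. -/
theorem density_product_ge {a s τ A A' B B' C C' W W' N N' : ℝ} (ha : 0 ≤ a) (hs : 0 ≤ s)
    (hsτ : s * τ = 1) (hA : |A| ≤ W * W) (hA' : |A'| ≤ W' * W')
    (hB : |B| ≤ N * N) (hB' : |B'| ≤ N' * N') (hC : |C| ≤ W * N) (hC' : |C'| ≤ W' * N') :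
    a ^ 4 * (A * A') - ((3 * a ^ 2 + a ^ 3 * τ + a * s) * (W ^ 2 * N' ^ 2 + N ^ 2 * W' ^ 2)
      + (1 + 2 * a * τ) * (N ^ 2 * N' ^ 2) + 2 * a ^ 3 * s * (W ^ 2 * W' ^ 2)) ≤
    (a ^ 2 * A + B + 2 * a * C) * (a ^ 2 * A' + B' + 2 * a * C') := by
  have key : ∀ {x y p q : ℝ}, |x| ≤ p → |y| ≤ q → -(p * q) ≤ x * y := fun {x y p q} hx hy => by
    have h1 : |x * y| ≤ p * q := by
      rw [abs_mul]; exact mul_le_mul hx hy (abs_nonneg _) ((abs_nonneg _).trans hx)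
    exact (abs_le.1 h1).1
  have amgm : ∀ x y : ℝ, 2 * (x * y) ≤ s * x ^ 2 + τ * y ^ 2 := fun x y => by
    have h1 : s * (s * x ^ 2 + τ * y ^ 2 - 2 * (x * y)) = (s * x - y) ^ 2 := by
      linear_combination (y ^ 2) * hsτ
    have hs0 : 0 < s := hs.lt_of_ne' fun h => by simp [h] at hsτ
    nlinarith [nonneg_of_mul_nonneg_right (h1 ▸ sq_nonneg (s * x - y) :
      0 ≤ s * (s * x ^ 2 + τ * y ^ 2 - 2 * (x * y))) hs0]
  have e1 := mul_le_mul_of_nonneg_left (key hA hB') (sq_nonneg a)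
  have e2 := mul_le_mul_of_nonneg_left (key hB hA') (sq_nonneg a)
  have e3 := key hB hB'
  have e4 := mul_le_mul_of_nonneg_left (key hC hC') (sq_nonneg a)
  have e5 := mul_le_mul_of_nonneg_left (key hA hC') (pow_nonneg ha 3)
  have e6 := mul_le_mul_of_nonneg_left (key hC hA') (pow_nonneg ha 3)
  have e7 := mul_le_mul_of_nonneg_left (key hB hC') ha
  have e8 := mul_le_mul_of_nonneg_left (key hC hB') ha
  have f4 := mul_le_mul_of_nonneg_left (two_mul_le_add_sq (W * N') (N * W')) (sq_nonneg a)
  have f5 := mul_le_mul_of_nonneg_left (amgm (W * W') (W * N')) (pow_nonneg ha 3)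
  have f6 := mul_le_mul_of_nonneg_left (amgm (W * W') (N * W')) (pow_nonneg ha 3)
  have f7 := mul_le_mul_of_nonneg_left (amgm (N * W') (N * N')) ha
  have f8 := mul_le_mul_of_nonneg_left (amgm (W * N') (N * N')) ha
  linarith

theorem coulombIntegrand_ge {a s τ : ℝ} (ha : 0 ≤ a) (hs : 0 ≤ s)
    (hsτ : s * τ = 1) {w η ψ : L2} (hψ : ψ = (a : ℂ) • w + η) :
    ∀ᵐ z : R3 × R3, a ^ 4 * coulombIntegrand w z
      - ((3 * a ^ 2 + a ^ 3 * τ + a * s) * (pairIntegrand w η z + pairIntegrand η w z)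
        + (1 + 2 * a * τ) * pairIntegrand η η z + 2 * a ^ 3 * s * pairIntegrand w w z) ≤
      coulombIntegrand ψ z := by
  have h0 : ∀ᵐ x : R3, density ψ x = a ^ 2 * betaForm (w x) (w x) + betaForm (η x) (η x)
      + 2 * a * betaForm (w x) (η x) := by
    rw [hψ]
    filter_upwards [Lp.coeFn_add ((a : ℂ) • w) η, Lp.coeFn_smul (a : ℂ) w] with x h1 h2
    rw [← betaForm_smul_add, ← Pi.smul_apply (a : ℂ) (w : R3 → C4), ← h2, ← Pi.add_apply, ← h1]
    rfl
  have h1 : ∀ᵐ z : R3 × R3, density ψ z.1 = a ^ 2 * betaForm (w z.1) (w z.1)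
      + betaForm (η z.1) (η z.1) + 2 * a * betaForm (w z.1) (η z.1) :=
    Measure.quasiMeasurePreserving_fst.ae h0
  have h2 : ∀ᵐ z : R3 × R3, density ψ z.2 = a ^ 2 * betaForm (w z.2) (w z.2)
      + betaForm (η z.2) (η z.2) + 2 * a * betaForm (w z.2) (η z.2) :=
    Measure.quasiMeasurePreserving_snd.ae h0
  filter_upwards [h1, h2] with z hz1 hz2
  have h := density_product_ge ha hs hsτ
    (abs_betaForm_le (w z.1) (w z.1)) (abs_betaForm_le (w z.2) (w z.2))
    (abs_betaForm_le (η z.1) (η z.1)) (abs_betaForm_le (η z.2) (η z.2))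
    (abs_betaForm_le (w z.1) (η z.1)) (abs_betaForm_le (w z.2) (η z.2))
  have h3 := div_le_div_of_nonneg_right h (norm_nonneg (z.1 - z.2))
  rw [← hz1, ← hz2] at h3
  refine le_trans (le_of_eq ?_) h3
  simp only [coulombIntegrand, pairIntegrand, density, betaForm]
  ring

theorem coulombEnergy_ge {a s τ : ℝ} (ha : 0 ≤ a) (hs : 0 ≤ s)
    (hsτ : s * τ = 1) {w η ψ : L2} (hw : HalfRegular w) (hη : HalfRegular η)
    (hψ : ψ = (a : ℂ) • w + η) :
    a ^ 4 * coulombEnergy w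
      - ((3 * a ^ 2 + a ^ 3 * τ + a * s) * (2 * ∫ z, pairIntegrand w η z)
        + (1 + 2 * a * τ) * (∫ z, pairIntegrand η η z)
        + 2 * a ^ 3 * s * ∫ z, pairIntegrand w w z) ≤ coulombEnergy ψ := by
  have hψr : HalfRegular ψ := hψ ▸ halfRegular_smul_add hw hη a
  have iw := (integrable_coulombIntegrand hw).const_mul (a ^ 4)
  have i1 := ((integrable_pairIntegrand hw η).add (integrable_pairIntegrand hη w)).const_mul
    (3 * a ^ 2 + a ^ 3 * τ + a * s)
  have i2 := (integrable_pairIntegrand hη η).const_mul (1 + 2 * a * τ)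
  have i3 := (integrable_pairIntegrand hw w).const_mul (2 * a ^ 3 * s)
  have h := integral_mono_ae (iw.sub ((i1.add i2).add i3)) (integrable_coulombIntegrand hψr)
    (coulombIntegrand_ge ha hs hsτ hψ)
  rw [integral_sub' iw ((i1.add i2).add i3), integral_add' (i1.add i2) i3, integral_add' i1 i2,
    integral_const_mul, integral_const_mul, integral_const_mul, integral_const_mul,
    integral_add' (integrable_pairIntegrand hw η) (integrable_pairIntegrand hη w),
    ← integral_pairIntegrand_comm w η, ← two_mul] at h
  exact h

theorem coulombEnergy_le {w : L2} (hw : HalfRegular w) :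
    coulombEnergy w ≤ ∫ z, pairIntegrand w w z :=
  integral_mono (integrable_coulombIntegrand hw) (integrable_pairIntegrand hw w) fun z =>
    (le_abs_self _).trans (abs_coulombIntegrand_le w z)

/-! ### Collecting constants and conclusion. -/

/-- The mixed energy WN has two bounds: 2Ps² is used where the coefficient contains 1/s, and 2E
elsewhere. The errors add up to at most πs²H + 10a²(H-m) + 26Hη, and π > 3 makes 7π and 9π
sufficient. -/
theorem energy_bound {a s m P E H Hη D D' WW WN NN : ℝ} (ha : 0 ≤ a) (hs0 : 0 < s) (hs1 : s ≤ 1)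
    (has : a ^ 2 + s ^ 2 = 1) (hm : 0 ≤ m) (hmw : m ≤ H) (hmη : m * s ^ 2 ≤ Hη) (hPw : P ≤ H)
    (hPη : E ≤ Hη) (hsP : s * P ≤ 1 / 2 * ((H - m) + s ^ 2 * (H + m))) (hP0 : 0 ≤ P) (hE0 : 0 ≤ E)
    (hD : D ≤ 2 * P) (hWW : WW ≤ 2 * P) (hWN : WN ≤ 2 * P * s ^ 2) (hNW : WN ≤ 2 * E)
    (hNN : NN ≤ 2 * E * s ^ 2)
    (hge : a ^ 4 * D - ((3 * a ^ 2 + a ^ 3 * s⁻¹ + a * s) * (2 * WN) + (1 + 2 * a * s⁻¹) * NN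
      + 2 * a ^ 3 * s * WW) ≤ D') :
    D - Real.pi * s ^ 2 * H - 7 * Real.pi * (a ^ 2 * (H - m)) - 9 * Real.pi * Hη ≤ D' := by
  have hpi := Real.pi_gt_three
  have hη0 : 0 ≤ Hη := hE0.trans hPη
  have ha1 : a ≤ 1 := by nlinarith
  have h4 : a ^ 4 * D ≥ D - s ^ 2 * (1 + a ^ 2) * (2 * P) := by
    have e : a ^ 4 = 1 - s ^ 2 * (1 + a ^ 2) := by
      rw [← sub_eq_iff_eq_add'.2 has.symm]; ring
    rw [e]
    nlinarith [mul_le_mul_of_nonneg_left hD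
      (by positivity : 0 ≤ s ^ 2 * (1 + a ^ 2))]
  have t1 : a ^ 2 * WN ≤ a ^ 2 * (2 * E) := by gcongr
  have t2 : a * s * WN ≤ a * s * (2 * E) := by gcongr
  have t3 : a ^ 3 * s⁻¹ * WN ≤ a ^ 3 * (2 * P * s) := by
    calc a ^ 3 * s⁻¹ * WN ≤ a ^ 3 * s⁻¹ * (2 * P * s ^ 2) := by gcongr
      _ = a ^ 3 * (2 * P * s) := by field_simp
  have t4 : a * s⁻¹ * NN ≤ a * (2 * E * s) := by
    calc a * s⁻¹ * NN ≤ a * s⁻¹ * (2 * E * s ^ 2) := by gcongr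
      _ = a * (2 * E * s) := by field_simp
  have t5 : a ^ 3 * s * WW ≤ a ^ 3 * s * (2 * P) := by gcongr
  have hlow : D - (2 * s ^ 2 * P + a ^ 2 * (2 * s + 8 * a) * (s * P)
      + (12 * a ^ 2 + 2 * s ^ 2 + 8 * (a * s)) * E) ≤ D' := by
    linarith
  have u1 : 2 * s ^ 2 * P ≤ Real.pi * s ^ 2 * H := by
    have : s ^ 2 * P ≤ s ^ 2 * H := by gcongr
    nlinarith [mul_nonneg (sq_nonneg s) (hP0.trans hPw)]
  have hK : 0 ≤ H - m := sub_nonneg.2 hmw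
  have u2 : a ^ 2 * (2 * s + 8 * a) * (s * P) ≤ a ^ 2 * (10 * (H - m) + 10 * (m * s ^ 2)) := by
    have v1 : s * P ≤ (H - m) + m * s ^ 2 := by 
      have : s ^ 2 ≤ 1 := pow_le_one₀ hs0.le hs1
      nlinarith [mul_nonneg hK (sub_nonneg.2 this)]
    have v2 : (2 * s + 8 * a) * (s * P) ≤ 10 * (s * P) :=
      mul_le_mul_of_nonneg_right (by linarith) (by positivity)
    rw [mul_assoc]
    refine mul_le_mul_of_nonneg_left ?_ (sq_nonneg a)
    linarith
  have u3 : (12 * a ^ 2 + 2 * s ^ 2 + 8 * (a * s)) * E ≤ 16 * Hη := by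
    have v : 12 * a ^ 2 + 2 * s ^ 2 + 8 * (a * s) ≤ 16 := by
      nlinarith [sq_nonneg (a - s), sq_nonneg s]
    exact (mul_le_mul_of_nonneg_right v hE0).trans (by linarith)
  -- The mass remainder left over from s P is paid for by η, whose energy is at least m s².
  have u4 : a ^ 2 * (m * s ^ 2) ≤ Hη := by
    have : a ^ 2 ≤ 1 := pow_le_one₀ ha ha1
    nlinarith [mul_nonneg hm (sq_nonneg s)]
  have u5 : 21 * (a ^ 2 * (H - m)) ≤ 7 * Real.pi * (a ^ 2 * (H - m)) :=
    mul_le_mul_of_nonneg_right (by linarith) (by positivity)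
  have u6 : 27 * Hη ≤ 9 * Real.pi * Hη := mul_le_mul_of_nonneg_right (by linarith) hη0
  have u7 : 0 ≤ a ^ 2 * (H - m) := by positivity
  linarith

end DiracKG

theorem mainTheorem6 (m : ℝ) (hm : 0 < m) (w η ψ : DiracKG.L2)
    (hw : w ∈ DiracKG.SigmaPlus m) (hη : η ∈ DiracKG.XMinus m) (hη1 : ‖η‖ ≤ 1)
    (hψ : ψ = ((DiracKG.amp η : ℝ) : ℂ) • w + η) :
    Integrable (DiracKG.coulombIntegrand ψ) ∧ Integrable (DiracKG.coulombIntegrand w) ∧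
      DiracKG.coulombEnergy ψ ≥ DiracKG.coulombEnergy w
        - 2 * DiracKG.kappa * ‖η‖ ^ 2 * DiracKG.hNorm m w ^ 2
        - 14 * DiracKG.amp η ^ 2 * DiracKG.kappa *
            (DiracKG.hNorm m w ^ 2 - m * ‖w‖ ^ 2)
        - 18 * DiracKG.kappa * DiracKG.hNorm m η ^ 2 := by
  open DiracKG in
  obtain ⟨⟨w₀, hw₀, rfl⟩, hw1⟩ := hw
  obtain ⟨η₀, hη₀, rfl⟩ := hη
  have hwr := halfRegular_energyProj (m := m) (ε := 1) (halfRegular_of_mem_X hw₀)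
  have hηr := halfRegular_energyProj (m := m) (ε := -1) (halfRegular_of_mem_X hη₀)
  set w := energyProj m 1 w₀
  set η := energyProj m (-1) η₀
  have hψr : HalfRegular ψ := hψ ▸ halfRegular_smul_add hwr hηr _
  refine ⟨integrable_coulombIntegrand hψr, integrable_coulombIntegrand hwr, ?_⟩
  have ha : 0 ≤ amp η := Real.sqrt_nonneg _
  have has : amp η ^ 2 + ‖η‖ ^ 2 = 1 := by
    rw [amp, Real.sq_sqrt (by nlinarith [norm_nonneg η])]; ring
  have hmw := mass_mul_le hm.le hwr
  have hmη := mass_mul_le hm.le hηr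
  have hPw := momentumForm_le hm.le hwr
  have hPη := momentumForm_le hm.le hηr
  have hsP := mul_momentumForm_le hm.le hwr ‖η‖
  have hP0 := momentumForm_nonneg w
  have hE0 := momentumForm_nonneg η
  have hDw := coulombEnergy_le hwr
  have hWW := integral_pairIntegrand_le hwr w
  have hWN := integral_pairIntegrand_le hwr η
  have hNW := integral_pairIntegrand_le hηr w
  have hNN := integral_pairIntegrand_le hηr η
  rw [← integral_pairIntegrand_comm w η] at hNW
  simp only [hw1, one_pow, mul_one] at *
  -- The weight τ = 1/‖η‖ requires η ≠ 0; for η = 0 one has ψ = w and the subtracted terms are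
  -- nonnegative.
  rcases (norm_nonneg η).eq_or_lt with hs0 | hs0
  · have hη0 : η = 0 := norm_eq_zero.1 hs0.symm
    have ha1 : amp η = 1 := by rw [amp, ← hs0]; simp
    have hψw : ψ = w := by rw [hψ, ha1, hη0]; simp
    rw [hψw, ← hs0, ha1, kappa]
    nlinarith [mul_nonneg Real.pi_pos.le (sub_nonneg.2 hmw),
      mul_nonneg Real.pi_pos.le (sq_nonneg (hNorm m η))]
  have hge := coulombEnergy_ge ha hs0.le (mul_inv_cancel₀ hs0.ne') hwr hηr hψ
  have hfin := energy_bound ha hs0 hη1 has hm.le hmw hmη hPw hPη hsP hP0 hE0 (hDw.trans hWW)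
    hWW hWN hNW hNN hge
  simp only [kappa]
  linarith
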